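/- Let $n\ge 0$ and let $X,Y$ be independent random vectors in $\mathbb{R}^n$ that have densities with respect to Lebesgue measure and whose differential entropies are finite. Here the differential entropy of a random vector with density $f$ is $h=-\int_{\mathbb{R}^n} f\log f$, regarded as an element of $[-\infty,+\infty]$ whenever the positive and the negative part of $f\log f$ do not both have infinite integral; $h$ is finite exactly when $f\log f$ is integrable. Let $0<\lambda<1$. Then the equality $$h\bigl(\sqrt{\lambda}\,X+\sqrt{1-\lambda}\,Y\bigr)=\lambda\,h(X)+(1-\lambda)\,h(Y)$$ holds (in particular its left-hand side is defined and finite) if and only if $X$ and $Y$ are Gaussian with the same covariance matrix. (The means of $X$ and $Y$ are arbitrary; for $n=1$ and zero means the condition says that $X$ and $Y$ are Gaussian with the same power $\mathbb{E}X^2=\mathbb{E}Y^2$.) -/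

import Mathlib

open MeasureTheory ProbabilityTheory
open scoped ENNReal

/-- The differential entropy `h(X) = -∫ f log f` (natural logarithm, Lebesgue measure) of a random
vector `X` in `ℝⁿ` with density `f`, as an extended real number: the integral of the positive part
of `-f log f` minus the integral of its negative part. It is a finite real number if and only if
`f log f` is Lebesgue integrable; in the undefined case `∞ - ∞` the value is `⊥`. -/
noncomputable def diffEntropy {Ω : Type*} [MeasurableSpace Ω] {n : ℕ} (P : Measure Ω)
    (X : Ω → EuclideanSpace ℝ (Fin n)) : EReal :=
  ((∫⁻ x, ENNReal.ofReal (Real.negMulLog (pdf X P volume x).toReal) : ℝ≥0∞) : EReal) -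
    ((∫⁻ x, ENNReal.ofReal (-Real.negMulLog (pdf X P volume x).toReal) : ℝ≥0∞) : EReal)

/-! Put a = √λ and b = √(1-λ), so a² + b² = 1, and let γ be the standard Gaussian measure with
density φ. Let f, g, p be the densities of X, Y and aX + bY. Triangular increasing maps T, U (Knothe
maps) send γ to the laws of X and Y, with f(T)·∏ dᵢ = φ and g(U)·∏ eᵢ = φ almost everywhere, where
dᵢ, eᵢ are the diagonal derivatives (`exists_triangular_transport`).

Write two independent Gaussian vectors as ax - by and bx + ay, with x, y again independent Gaussian.
For fixed y the map S_y(x) = aT(ax - by) + bU(bx + ay) is triangular with diagonal derivatives a²dᵢ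
+ b²eᵢ, and these dominate dᵢ^(a²)·eᵢ^(b²). Change of variables then bounds the γ-integral of
p(S_y)·∏dᵢ^(a²)·∏eᵢ^(b²)/φ(x) by ∫ p = 1 (`lintegral_interpolation_le`). This integrand is exp r
almost everywhere, where by the Jacobian equations and a² + b² = 1 equality of entropies says
exactly ∫ r = 0. Hence r = 0 almost everywhere (`ae_eq_zero_of_lintegral_exp_le_one`).

Consequently almost every S_y transports γ to the law of aX + bY. A triangular map is determined by
the measure it produces (`IsTriangular.ae_eq_of_map_eq`), so S_y does not depend on y, that is aT(u)
+ bU(v) = S(au + bv). Measurable solutions of this Pexider equation are affine with a common linear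
part (`ae_eq_affine_of_pexider`), which gives Gaussian laws with equal covariances.

Conversely, for Gaussian vectors with equal covariances, Y and aX + bY are translates of X in law,
and entropy is translation invariant. -/

/-! ### Splitting off the last coordinate -/

/-- Appending a last coordinate, as a measurable equivalence. -/
def snocEquiv (n : ℕ) : (Fin n → ℝ) × ℝ ≃ᵐ (Fin (n + 1) → ℝ) where
  toFun p := Fin.snoc (α := fun _ => ℝ) p.1 p.2
  invFun x := (Fin.init x, x (Fin.last n))
  left_inv p := by simp
  right_inv x := by simp
  measurable_toFun := by
    refine measurable_pi_iff.2 fun i => ?_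
    refine Fin.lastCases ?_ (fun j => ?_) i
    · simpa using measurable_snd
    · simpa using! (measurable_pi_apply j).comp measurable_fst
  measurable_invFun :=
    (measurable_pi_iff.2 fun i => measurable_pi_apply i.castSucc).prodMk (measurable_pi_apply _)

@[simp] lemma snocEquiv_apply {n : ℕ} (p : (Fin n → ℝ) × ℝ) :
    snocEquiv n p = Fin.snoc (α := fun _ => ℝ) p.1 p.2 := rfl

lemma measurePreserving_snocEquiv (n : ℕ) (μ : Measure ℝ) [SigmaFinite μ] :
    MeasurePreserving (snocEquiv n) ((Measure.pi fun _ : Fin n => μ).prod μ)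
      (Measure.pi fun _ : Fin (n + 1) => μ) := by
  have h1 := (measurePreserving_piFinSuccAbove (fun _ : Fin (n + 1) => μ) (Fin.last n)).symm
  have h2 := h1.comp (Measure.measurePreserving_swap
    (μ := (Measure.pi fun _ : Fin n => μ)) (ν := μ))
  convert h2 using 1
  ext p i
  refine Fin.lastCases ?_ (fun j => ?_) i <;>
    simp [MeasurableEquiv.piFinSuccAbove]

lemma lintegral_pi_snoc {n : ℕ} (μ : Measure ℝ) [SigmaFinite μ]
    {f : (Fin (n + 1) → ℝ) → ℝ≥0∞} (hf : Measurable f) :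
    ∫⁻ x, f x ∂(Measure.pi fun _ => μ) =
      ∫⁻ y, ∫⁻ t, f (Fin.snoc (α := fun _ => ℝ) y t) ∂μ ∂(Measure.pi fun _ : Fin n => μ) := by
  rw [← (measurePreserving_snocEquiv n μ).lintegral_comp hf,
    lintegral_prod (fun p => f (snocEquiv n p)) (hf.comp (snocEquiv n).measurable).aemeasurable]
  rfl

lemma measurable_snoc {n : ℕ} :
    Measurable fun p : (Fin n → ℝ) × ℝ => Fin.snoc (α := fun _ => ℝ) p.1 p.2 :=
  (snocEquiv n).measurable

lemma measurable_init {n : ℕ} :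
    Measurable fun x : Fin (n + 1) → ℝ => (Fin.init x : Fin n → ℝ) :=
  measurable_pi_iff.2 fun i => measurable_pi_apply i.castSucc

lemma measurable_snoc_left {n : ℕ} (t : ℝ) :
    Measurable fun y : Fin n → ℝ => Fin.snoc (α := fun _ => ℝ) y t :=
  measurable_snoc.comp (measurable_id.prodMk measurable_const)

lemma measurable_snoc_right {n : ℕ} (y : Fin n → ℝ) :
    Measurable fun t : ℝ => Fin.snoc (α := fun _ => ℝ) y t :=
  measurable_snoc.comp (measurable_const.prodMk measurable_id)

/-! ### Triangular maps and their change of variables inequality -/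

/-- A triangular map whose `i`-th coordinate is strictly increasing in the `i`-th variable. -/
def IsTriangular {n : ℕ} (s : (Fin n → ℝ) → (Fin n → ℝ)) : Prop :=
  ∀ i x y, (∀ j < i, x j = y j) → (x i ≤ y i ↔ s x i ≤ s y i)

/-- The functions `d i` are the almost everywhere partial derivatives `∂ᵢ sᵢ` of the triangular
map `s`. -/
structure HasTriangularDeriv {n : ℕ} (s : (Fin n → ℝ) → (Fin n → ℝ))
    (d : Fin n → (Fin n → ℝ) → ℝ) : Prop where
  measurable : Measurable s
  triangular : IsTriangular s
  measurable_deriv : ∀ i, Measurable (d i)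
  nonneg : ∀ i x, 0 ≤ d i x
  congr : ∀ i x y, (∀ j ≤ i, x j = y j) → d i x = d i y
  hasDerivAt : ∀ i x, ∀ᵐ t : ℝ,
    HasDerivAt (fun t => s (Function.update x i t) i) (d i (Function.update x i t)) t

namespace IsTriangular

variable {n : ℕ}

/-- The defining equivalence, used in both directions between x and y, gives two opposite
inequalities. So triangularity already contains the fact that a component ignores later variables.
-/
lemma congr {s : (Fin n → ℝ) → (Fin n → ℝ)} (hs : IsTriangular s) {i : Fin n}
    {x y : Fin n → ℝ} (h : ∀ j ≤ i, x j = y j) : s x i = s y i :=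
  le_antisymm ((hs i x y fun j hj => h j hj.le).1 (h i le_rfl).le)
    ((hs i y x fun j hj => (h j hj.le).symm).1 (h i le_rfl).ge)

lemma injective {s : (Fin n → ℝ) → (Fin n → ℝ)} (hs : IsTriangular s) :
    Function.Injective s := by
  intro x y hxy
  funext i
  induction i using WellFoundedLT.induction with
  | ind i ih =>
    exact le_antisymm ((hs i x y ih).2 (congrFun hxy i).le)
      ((hs i y x fun j hj => (ih j hj).symm).2 (congrFun hxy i).ge)

lemma strictMono_update {s : (Fin n → ℝ) → (Fin n → ℝ)} (hs : IsTriangular s) (i : Fin n)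
    (x : Fin n → ℝ) : StrictMono fun t => s (Function.update x i t) i := by
  intro t u htu
  have := hs i (Function.update x i u) (Function.update x i t) fun j hj => by
    simp [hj.ne]
  simp only [Function.update_self] at this
  exact lt_of_not_ge fun h => htu.not_ge (this.2 h)

/-- The action of a triangular map on the first `n` coordinates. -/
def initMap (s : (Fin (n + 1) → ℝ) → (Fin (n + 1) → ℝ)) (y : Fin n → ℝ) : Fin n → ℝ :=
  Fin.init (s (Fin.snoc (α := fun _ => ℝ) y 0))

lemma measurable_initMap {s : (Fin (n + 1) → ℝ) → (Fin (n + 1) → ℝ)} (hs : Measurable s) :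
    Measurable (initMap s) :=
  measurable_init.comp (hs.comp (measurable_snoc_left 0))

lemma snoc_eq_of_le_castSucc (i : Fin n) (y : Fin n → ℝ) (t u : ℝ) (j : Fin (n + 1))
    (hj : j ≤ i.castSucc) :
    Fin.snoc (α := fun _ => ℝ) y t j = Fin.snoc (α := fun _ => ℝ) y u j := by
  revert hj
  refine Fin.lastCases (fun hj => ?_) (fun k hk => ?_) j
  · exact absurd hj (not_le.2 (Fin.castSucc_lt_last i))
  · simp

/-- The first n components ignore the last variable, so the value 0 inserted in `initMap` is
immaterial. This is the decomposition behind every induction on the dimension. -/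
lemma apply_snoc {s : (Fin (n + 1) → ℝ) → (Fin (n + 1) → ℝ)} (hs : IsTriangular s)
    (y : Fin n → ℝ) (t : ℝ) :
    s (Fin.snoc (α := fun _ => ℝ) y t) =
      Fin.snoc (α := fun _ => ℝ) (initMap s y) (s (Fin.snoc (α := fun _ => ℝ) y t) (Fin.last n)) := by
  funext i
  refine Fin.lastCases ?_ (fun j => ?_) i
  · simp
  · simp only [Fin.snoc_castSucc, initMap, Fin.init]
    exact hs.congr (snoc_eq_of_le_castSucc j y t 0)

lemma initMap_isTriangular {s : (Fin (n + 1) → ℝ) → (Fin (n + 1) → ℝ)} (hs : IsTriangular s) :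
    IsTriangular (initMap s) := by
  intro i x y h
  have := hs i.castSucc (Fin.snoc (α := fun _ => ℝ) x 0) (Fin.snoc (α := fun _ => ℝ) y 0) ?_
  · simpa [initMap, Fin.init] using this
  · intro j
    refine Fin.lastCases (fun hj => by simp) (fun k hk => ?_) j
    simpa using h k (by simpa using hk)

lemma strictMono_last {s : (Fin (n + 1) → ℝ) → (Fin (n + 1) → ℝ)} (hs : IsTriangular s)
    (y : Fin n → ℝ) :
    StrictMono fun t => s (Fin.snoc (α := fun _ => ℝ) y t) (Fin.last n) := by
  simpa only [Fin.update_snoc_last] using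
    hs.strictMono_update (Fin.last n) (Fin.snoc (α := fun _ => ℝ) y 0)

end IsTriangular

/-- A one-dimensional change of variables inequality. -/
lemma lintegral_comp_mul_deriv_le {s d : ℝ → ℝ} (hs : StrictMono s)
    (hd : ∀ᵐ t, HasDerivAt s (d t) t) (p : ℝ → ℝ≥0∞) :
    ∫⁻ t, p (s t) * ENNReal.ofReal (d t) ≤ ∫⁻ z, p z := by
  obtain ⟨N, hN, hNm, hN0⟩ := exists_measurable_superset_of_null hd
  have h := lintegral_image_eq_lintegral_deriv_mul_of_monotoneOn hNm.compl
    (f := s) (f' := d) (fun x hx => by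
      have : HasDerivAt s (d x) x := by
        by_contra hc
        exact hx (hN hc)
      exact this.hasDerivWithinAt) (hs.monotone.monotoneOn _) p
  calc ∫⁻ t, p (s t) * ENNReal.ofReal (d t)
      = ∫⁻ t in Nᶜ, p (s t) * ENNReal.ofReal (d t) := by
        rw [← setLIntegral_univ]
        refine setLIntegral_congr ?_
        exact (ae_eq_univ.2 (by simpa using hN0)).symm
    _ = ∫⁻ z in s '' Nᶜ, p z := by simp_rw [h, mul_comm]
    -- Only an inequality is available: s may jump, and it may send the null set N to a set of
    -- positive measure.
    _ ≤ ∫⁻ z, p z := setLIntegral_le_lintegral _ _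

namespace HasTriangularDeriv

variable {n : ℕ}

lemma initMap {s : (Fin (n + 1) → ℝ) → (Fin (n + 1) → ℝ)}
    {d : Fin (n + 1) → (Fin (n + 1) → ℝ) → ℝ} (h : HasTriangularDeriv s d) :
    HasTriangularDeriv (IsTriangular.initMap s)
      (fun i y => d i.castSucc (Fin.snoc (α := fun _ => ℝ) y 0)) where
  measurable := IsTriangular.measurable_initMap h.measurable
  triangular := h.triangular.initMap_isTriangular
  measurable_deriv i := (h.measurable_deriv _).comp (measurable_snoc_left 0)
  nonneg i x := h.nonneg _ _
  congr i x y hxy := by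
    refine h.congr _ _ _ fun j => ?_
    refine Fin.lastCases (fun hj => by simp) (fun k hk => ?_) j
    simpa using hxy k (by simpa using hk)
  hasDerivAt i x := by
    have := h.hasDerivAt i.castSucc (Fin.snoc (α := fun _ => ℝ) x 0)
    simpa only [IsTriangular.initMap, Fin.init, Fin.snoc_update] using this

/-- The change of variables inequality for triangular maps. -/
theorem lintegral_comp_mul_prod_le {n : ℕ} {s : (Fin n → ℝ) → (Fin n → ℝ)}
    {d : Fin n → (Fin n → ℝ) → ℝ} (h : HasTriangularDeriv s d) {p : (Fin n → ℝ) → ℝ≥0∞}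
    (hp : Measurable p) :
    ∫⁻ x, p (s x) * ∏ i, ENNReal.ofReal (d i x) ≤ ∫⁻ z, p z := by
  induction n with
  | zero =>
    simp only [Finset.univ_eq_empty, Finset.prod_empty, mul_one]
    exact le_of_eq (lintegral_congr fun x => congrArg p (Subsingleton.elim _ _))
  | succ n ih =>
    have hm : Measurable fun x => p (s x) * ∏ i, ENNReal.ofReal (d i x) :=
      (hp.comp h.measurable).mul (Finset.measurable_prod _ fun i _ =>
        (h.measurable_deriv i).ennreal_ofReal)
    have hq : Measurable fun z : Fin n → ℝ => ∫⁻ t, p (Fin.snoc (α := fun _ => ℝ) z t) :=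
      (hp.comp measurable_snoc).lintegral_prod_right'
    rw [volume_pi, lintegral_pi_snoc _ hm, lintegral_pi_snoc _ hp]
    -- The induction hypothesis is applied to the marginal of p in the last variable; the
    -- one-dimensional inequality is left on each fibre.
    refine le_trans (lintegral_mono fun y => ?_) (ih h.initMap hq)
    have key : ∀ t, p (s (Fin.snoc (α := fun _ => ℝ) y t)) *
        ∏ i, ENNReal.ofReal (d i (Fin.snoc (α := fun _ => ℝ) y t)) =
        (∏ i : Fin n, ENNReal.ofReal (d i.castSucc (Fin.snoc (α := fun _ => ℝ) y 0))) *
        (p (Fin.snoc (α := fun _ => ℝ) (IsTriangular.initMap s y)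
          (s (Fin.snoc (α := fun _ => ℝ) y t) (Fin.last n))) *
        ENNReal.ofReal (d (Fin.last n) (Fin.snoc (α := fun _ => ℝ) y t))) := by
      intro t
      rw [Fin.prod_univ_castSucc, ← h.triangular.apply_snoc y t]
      have : ∀ i : Fin n, d i.castSucc (Fin.snoc (α := fun _ => ℝ) y t) =
          d i.castSucc (Fin.snoc (α := fun _ => ℝ) y 0) := fun i =>
        h.congr _ _ _ (IsTriangular.snoc_eq_of_le_castSucc i y t 0)
      simp_rw [this]
      ring
    simp_rw [key]
    rw [lintegral_const_mul', mul_comm]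
    · refine mul_le_mul' ?_ le_rfl
      have hd := h.hasDerivAt (Fin.last n) (Fin.snoc (α := fun _ => ℝ) y 0)
      simp only [Fin.update_snoc_last] at hd
      exact lintegral_comp_mul_deriv_le (h.triangular.strictMono_last y) hd
        (fun z => p (Fin.snoc (α := fun _ => ℝ) (IsTriangular.initMap s y) z))
    · exact (ENNReal.prod_lt_top fun i _ => ENNReal.ofReal_lt_top).ne

end HasTriangularDeriv

/-! ### Uniqueness of triangular transport -/

/-- Two upper sets of a linear order with the same finite measure coincide almost everywhere. -/
lemma ae_mem_iff_of_isUpperSet {α : Type*} [LinearOrder α] [MeasurableSpace α] {μ : Measure α}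
    [IsFiniteMeasure μ] {A B : Set α} (hA : IsUpperSet A) (hB : IsUpperSet B)
    (hAm : MeasurableSet A) (hBm : MeasurableSet B) (h : μ A = μ B) :
    ∀ᵐ x ∂μ, x ∈ A ↔ x ∈ B := by
  -- Upper sets of a linear order are nested, so equal finite measure leaves only a null difference.
  rcases hA.total hB with hAB | hBA
  · exact (ae_eq_of_subset_of_measure_ge hAB h.ge hAm.nullMeasurableSet (measure_ne_top _ _)).mem_iff
  · exact ((ae_eq_of_subset_of_measure_ge hBA h.le hBm.nullMeasurableSet
      (measure_ne_top _ _)).mem_iff).mono fun x hx => hx.symm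

/-- Two triangular maps with the same image of a product measure coincide almost everywhere. -/
theorem IsTriangular.ae_eq_of_map_eq {n : ℕ} (μ : Measure ℝ) [IsProbabilityMeasure μ]
    {s r : (Fin n → ℝ) → (Fin n → ℝ)} (hs : IsTriangular s) (hr : IsTriangular r)
    (hsm : Measurable s) (hrm : Measurable r)
    (h : (Measure.pi fun _ => μ).map s = (Measure.pi fun _ => μ).map r) :
    s =ᵐ[Measure.pi fun _ => μ] r := by
  induction n with
  | zero => exact Filter.Eventually.of_forall fun x => Subsingleton.elim _ _
  | succ n ih =>
    have e := measurePreserving_snocEquiv n μ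
    set s' := IsTriangular.initMap s
    set r' := IsTriangular.initMap r
    have hs'm : Measurable s' := measurable_initMap hsm
    have hr'm : Measurable r' := measurable_initMap hrm
    -- Disintegration of the image measure on product sets. Taking C to be everything compares the
    -- first n components; taking half-lines compares the last one.
    have rect : ∀ {s : (Fin (n + 1) → ℝ) → (Fin (n + 1) → ℝ)} (_ : IsTriangular s)
        (_ : Measurable s) {B : Set (Fin n → ℝ)} {C : Set ℝ} (_ : MeasurableSet B)
        (_ : MeasurableSet C),
        (Measure.pi fun _ => μ).map s {z | Fin.init z ∈ B ∧ z (Fin.last n) ∈ C} =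
          ∫⁻ y in {y | IsTriangular.initMap s y ∈ B},
            μ {t | s (Fin.snoc (α := fun _ => ℝ) y t) (Fin.last n) ∈ C}
              ∂(Measure.pi fun _ : Fin n => μ) := by
      intro s hs hsm B C hB hC
      have hBC : MeasurableSet {z : Fin (n + 1) → ℝ | Fin.init z ∈ B ∧ z (Fin.last n) ∈ C} :=
        (measurable_init hB).inter (measurable_pi_apply (Fin.last n) hC)
      rw [Measure.map_apply hsm hBC, ← lintegral_indicator_one (hsm hBC),
        lintegral_pi_snoc _ (measurable_one.indicator (hsm hBC)),
        ← lintegral_indicator (s := {y | IsTriangular.initMap s y ∈ B}) (measurable_initMap hsm hB)]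
      refine lintegral_congr fun y => ?_
      by_cases hy : IsTriangular.initMap s y ∈ B
      · rw [Set.indicator_of_mem (by exact hy), ← lintegral_indicator_one
          (s := {t | s (Fin.snoc (α := fun _ => ℝ) y t) (Fin.last n) ∈ C})
          ((measurable_pi_apply (Fin.last n)).comp (hsm.comp (measurable_snoc_right y)) hC)]
        refine lintegral_congr fun t => ?_
        have : (Fin.init (s (Fin.snoc (α := fun _ => ℝ) y t)) : Fin n → ℝ) ∈ B := by
          rw [hs.apply_snoc y t]; simpa using hy
        by_cases ht : s (Fin.snoc (α := fun _ => ℝ) y t) (Fin.last n) ∈ C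
        · rw [Set.indicator_of_mem (by exact ⟨this, ht⟩), Set.indicator_of_mem (by exact ht)]
          rfl
        · rw [Set.indicator_of_notMem (by exact fun hc => ht hc.2),
            Set.indicator_of_notMem (by exact ht)]
      · rw [Set.indicator_of_notMem (by exact hy)]
        refine lintegral_eq_zero_of_ae_eq_zero (Filter.Eventually.of_forall fun t => ?_)
        have : ¬ (Fin.init (s (Fin.snoc (α := fun _ => ℝ) y t)) : Fin n → ℝ) ∈ B := by
          rw [hs.apply_snoc y t]; simpa using hy
        simp [this]
    have h' : s' =ᵐ[Measure.pi fun _ => μ] r' := by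
      refine ih hs.initMap_isTriangular hr.initMap_isTriangular hs'm hr'm ?_
      ext B hB
      have h1 := rect hs hsm hB MeasurableSet.univ
      have h2 := rect hr hrm hB MeasurableSet.univ
      rw [h, h2] at h1
      simp only [Set.mem_univ, Set.ofPred_true, measure_univ, lintegral_const,
        Measure.restrict_apply_univ, one_mul] at h1
      rw [Measure.map_apply hs'm hB, Measure.map_apply hr'm hB]
      exact h1.symm
    have hq : ∀ q : ℚ, ∀ᵐ y ∂(Measure.pi fun _ : Fin n => μ),
        μ {t | s (Fin.snoc (α := fun _ => ℝ) y t) (Fin.last n) ∈ Set.Ioi (q : ℝ)} =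
        μ {t | r (Fin.snoc (α := fun _ => ℝ) y t) (Fin.last n) ∈ Set.Ioi (q : ℝ)} := by
      intro q
      have hmeas : ∀ {s : (Fin (n + 1) → ℝ) → (Fin (n + 1) → ℝ)}, Measurable s →
          Measurable fun y : Fin n → ℝ =>
            μ {t | s (Fin.snoc (α := fun _ => ℝ) y t) (Fin.last n) ∈ Set.Ioi (q : ℝ)} := by
        intro s hsm
        exact measurable_measure_prodMk_left
          ((measurable_pi_apply (Fin.last n)).comp (hsm.comp measurable_snoc) measurableSet_Ioi)
      refine ae_eq_of_forall_setLIntegral_eq_of_sigmaFinite (hmeas hsm) (hmeas hrm) ?_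
      intro A hA _
      -- By injectivity, `s'` pulls its image of A back to A itself, and `r'` does so up to a null
      -- set. Thus arbitrary A can be tested by product sets; measurability of the image is the
      -- Lusin–Souslin theorem.
      have hB : MeasurableSet (s' '' A) :=
        hA.image_of_measurable_injOn hs'm hs.initMap_isTriangular.injective.injOn
      have h1 := rect hs hsm hB (measurableSet_Ioi (a := (q : ℝ)))
      rw [h, rect hr hrm hB (measurableSet_Ioi (a := (q : ℝ)))] at h1
      have e1 : {y | IsTriangular.initMap s y ∈ s' '' A} = A :=
        hs.initMap_isTriangular.injective.preimage_image A
      have e2 : ({y | IsTriangular.initMap r y ∈ s' '' A} : Set (Fin n → ℝ))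
          =ᵐ[Measure.pi fun _ => μ] A := by
        filter_upwards [h'] with y hy
        refine propext ?_
        change r' y ∈ s' '' A ↔ y ∈ A
        rw [← hy]
        exact hs.initMap_isTriangular.injective.mem_set_image
      rw [e1, setLIntegral_congr e2] at h1
      exact h1.symm
    have hae : ∀ᵐ y ∂(Measure.pi fun _ : Fin n => μ), ∀ᵐ t ∂μ,
        s (Fin.snoc (α := fun _ => ℝ) y t) = r (Fin.snoc (α := fun _ => ℝ) y t) := by
      filter_upwards [h', ae_all_iff.2 hq] with y hy hqy
      have hup : ∀ {s : (Fin (n + 1) → ℝ) → (Fin (n + 1) → ℝ)}, IsTriangular s → ∀ q : ℚ,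
          IsUpperSet {t | s (Fin.snoc (α := fun _ => ℝ) y t) (Fin.last n) ∈ Set.Ioi (q : ℝ)} :=
        fun hs q t u htu ht => lt_of_lt_of_le ht ((hs.strictMono_last y).monotone htu)
      have hms : ∀ {s : (Fin (n + 1) → ℝ) → (Fin (n + 1) → ℝ)}, Measurable s → ∀ q : ℚ,
          MeasurableSet {t | s (Fin.snoc (α := fun _ => ℝ) y t) (Fin.last n) ∈ Set.Ioi (q : ℝ)} :=
        fun hsm q => (measurable_pi_apply (Fin.last n)).comp (hsm.comp (measurable_snoc_right y))
          measurableSet_Ioi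
      have := ae_all_iff.2 fun q : ℚ => ae_mem_iff_of_isUpperSet (hup hs q) (hup hr q)
        (hms hsm q) (hms hrm q) (hqy q)
      filter_upwards [this] with t ht
      rw [hs.apply_snoc y t, hr.apply_snoc y t]
      change Fin.snoc (α := fun _ => ℝ) (s' y) _ = Fin.snoc (α := fun _ => ℝ) (r' y) _
      rw [hy]
      congr 1
      simp only [Set.mem_Ioi] at ht
      -- Two real numbers that exceed the same rationals are equal.
      refine le_antisymm (le_of_forall_rat_lt_imp_le fun q hq => ((ht q).1 hq).le)
        (le_of_forall_rat_lt_imp_le fun q hq => ((ht q).2 hq).le)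
    have hset : MeasurableSet {p : (Fin n → ℝ) × ℝ | s (Fin.snoc (α := fun _ => ℝ) p.1 p.2) =
        r (Fin.snoc (α := fun _ => ℝ) p.1 p.2)} :=
      measurableSet_eq_fun (hsm.comp measurable_snoc) (hrm.comp measurable_snoc)
    have hprod := (Measure.ae_prod_iff_ae_ae hset).2 hae
    rw [← e.map_eq]
    refine (ae_map_iff (snocEquiv n).measurable.aemeasurable
      (measurableSet_eq_fun hsm hrm)).2 ?_
    exact hprod

/-! ### Monotone transport from the Gaussian measure on the line -/

open Set Filter Topology in
lemma continuous_cdf (m : Measure ℝ) [IsProbabilityMeasure m] (h : ∀ x, m {x} = 0) :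
    Continuous (cdf m) := by
  refine continuous_iff_continuousAt.2 fun x => ?_
  rw [(monotone_cdf m).continuousAt_iff_leftLim_eq_rightLim, StieltjesFunction.rightLim_eq]
  have h1 := (cdf m).measure_singleton x
  rw [measure_cdf, h x] at h1
  have h2 := ENNReal.ofReal_eq_zero.1 h1.symm
  exact le_antisymm ((monotone_cdf m).leftLim_le le_rfl) (by linarith)

/-- The quantile function of a probability measure on the line. -/
noncomputable def quantile (m : Measure ℝ) (y : ℝ) : ℝ := sInf {t | y ≤ cdf m t}

section Quantile

open Set Filter Topology

variable {m : Measure ℝ} [IsProbabilityMeasure m]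

/-- Without atoms the superlevel set of the cdf is closed, and for y strictly between 0 and 1 it is
nonempty and bounded below, so its infimum is attained. This Galois connection governs both the law
and the measurability of the transport. -/
lemma quantile_le_iff (h : ∀ x, m {x} = 0) {y : ℝ} (hy : y ∈ Ioo (0 : ℝ) 1) (t : ℝ) :
    quantile m y ≤ t ↔ y ≤ cdf m t := by
  have hc := continuous_cdf m h
  have hcl : IsClosed {t | y ≤ cdf m t} := isClosed_le continuous_const hc
  obtain ⟨u, hu⟩ := ((tendsto_cdf_atTop m).eventually (lt_mem_nhds hy.2)).exists
  obtain ⟨v, hv⟩ := ((tendsto_cdf_atBot m).eventually (gt_mem_nhds hy.1)).exists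
  have hne : {t | y ≤ cdf m t}.Nonempty := ⟨u, hu.le⟩
  have hbd : BddBelow {t | y ≤ cdf m t} := by
    refine ⟨v, fun t ht => ?_⟩
    by_contra hlt
    exact absurd (monotone_cdf m (not_le.1 hlt).le) (not_le.2 (hv.trans_le ht))
  constructor
  · intro hle
    exact le_trans (hcl.csInf_mem hne hbd) (monotone_cdf m hle)
  · intro hle
    exact csInf_le hbd hle

/-- The intermediate value theorem supplies a preimage of y. Only a right inverse is obtained, as
the cdf may have flat stretches. -/
lemma cdf_quantile (h : ∀ x, m {x} = 0) {y : ℝ} (hy : y ∈ Ioo (0 : ℝ) 1) :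
    cdf m (quantile m y) = y := by
  have hc := continuous_cdf m h
  obtain ⟨u, hu⟩ := ((tendsto_cdf_atTop m).eventually (lt_mem_nhds hy.2)).exists
  obtain ⟨v, hv⟩ := ((tendsto_cdf_atBot m).eventually (gt_mem_nhds hy.1)).exists
  obtain ⟨t, ht⟩ := mem_range_of_exists_le_of_exists_ge hc ⟨v, hv.le⟩ ⟨u, hu.le⟩
  refine le_antisymm ?_ ((quantile_le_iff h hy _).1 le_rfl)
  exact (monotone_cdf m ((quantile_le_iff h hy t).2 ht.ge)).trans ht.le

lemma strictMono_cdf_gaussianReal : StrictMono (cdf (gaussianReal 0 1)) := by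
  intro x y hxy
  refine lt_of_le_of_ne (monotone_cdf _ hxy.le) fun heq => ?_
  have h1 := (cdf (gaussianReal 0 1)).measure_Ioc x y
  rw [measure_cdf, heq, sub_self, ENNReal.ofReal_zero] at h1
  have := gaussianReal_absolutelyContinuous' 0 one_ne_zero h1
  rw [Real.volume_Ioc, ENNReal.ofReal_eq_zero] at this
  linarith

lemma cdf_gaussianReal_mem_Ioo (x : ℝ) : cdf (gaussianReal 0 1) x ∈ Ioo (0 : ℝ) 1 :=
  ⟨(cdf_nonneg _ (x - 1)).trans_lt (strictMono_cdf_gaussianReal (by linarith)),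
    (strictMono_cdf_gaussianReal (by linarith : x < x + 1)).trans_le (cdf_le_one _ _)⟩

lemma gaussianReal_singleton (x : ℝ) : gaussianReal 0 1 {x} = 0 :=
  gaussianReal_absolutelyContinuous 0 one_ne_zero Real.volume_singleton

/-- Uniformity of the probability integral transform. The endpoints 0 and 1, where the quantile is
not controlled, are treated separately. -/
lemma gaussianReal_setOf_cdf_le {c : ℝ} (hc : c ∈ Icc (0 : ℝ) 1) :
    gaussianReal 0 1 {x | cdf (gaussianReal 0 1) x ≤ c} = ENNReal.ofReal c := by
  rcases hc.1.eq_or_lt with rfl | h0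
  · have : {x | cdf (gaussianReal 0 1) x ≤ 0} = ∅ := by
      ext x; simpa using (cdf_gaussianReal_mem_Ioo x).1
    rw [this]; simp
  rcases hc.2.eq_or_lt with rfl | h1
  · have : {x | cdf (gaussianReal 0 1) x ≤ 1} = univ := by
      ext x; simpa using (cdf_gaussianReal_mem_Ioo x).2.le
    rw [this]; simp
  · have hq := cdf_quantile (m := gaussianReal 0 1) gaussianReal_singleton ⟨h0, h1⟩
    have : {x | cdf (gaussianReal 0 1) x ≤ c} = Iic (quantile (gaussianReal 0 1) c) := by
      ext x
      change _ ≤ c ↔ _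
      rw [← strictMono_cdf_gaussianReal.le_iff_le.trans (by rfl : _ ↔ x ∈ Iic _), hq]
    rw [this, ← ofReal_cdf, hq]

/-- The increasing map that sends the standard Gaussian measure to `m`. -/
noncomputable def gaussianTransport (m : Measure ℝ) (x : ℝ) : ℝ :=
  quantile m (cdf (gaussianReal 0 1) x)

lemma cdf_gaussianTransport (h : ∀ x, m {x} = 0) (x : ℝ) :
    cdf m (gaussianTransport m x) = cdf (gaussianReal 0 1) x :=
  cdf_quantile h (cdf_gaussianReal_mem_Ioo x)

lemma gaussianTransport_le_iff (h : ∀ x, m {x} = 0) (x t : ℝ) :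
    gaussianTransport m x ≤ t ↔ cdf (gaussianReal 0 1) x ≤ cdf m t :=
  quantile_le_iff h (cdf_gaussianReal_mem_Ioo x) t

lemma strictMono_gaussianTransport (h : ∀ x, m {x} = 0) : StrictMono (gaussianTransport m) := by
  intro x y hxy
  by_contra hc
  have := monotone_cdf m (not_lt.1 hc)
  rw [cdf_gaussianTransport h, cdf_gaussianTransport h] at this
  exact (strictMono_cdf_gaussianReal hxy).not_ge this

lemma map_gaussianTransport (h : ∀ x, m {x} = 0) :
    (gaussianReal 0 1).map (gaussianTransport m) = m := by
  have hm : Measurable (gaussianTransport m) := (strictMono_gaussianTransport h).monotone.measurable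
  have := Measure.isProbabilityMeasure_map (μ := gaussianReal 0 1) hm.aemeasurable
  refine Measure.ext_of_Iic _ _ fun t => ?_
  rw [Measure.map_apply hm measurableSet_Iic, ← ofReal_cdf]
  have : gaussianTransport m ⁻¹' Iic t = {x | cdf (gaussianReal 0 1) x ≤ cdf m t} := by
    ext x; exact gaussianTransport_le_iff h x t
  rw [this, gaussianReal_setOf_cdf_le ⟨cdf_nonneg _ _, cdf_le_one _ _⟩]

/-- Joint measurability in parameter and point, needed because the conditional laws vary with the
earlier coordinates. The Galois connection turns sublevel sets into comparisons of cdfs. -/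
lemma measurable_gaussianTransport {α : Type*} [MeasurableSpace α] {m : α → Measure ℝ}
    [∀ a, IsProbabilityMeasure (m a)] (h : ∀ a x, m a {x} = 0)
    (hm : ∀ t, Measurable fun a => m a (Iic t)) :
    Measurable fun p : α × ℝ => gaussianTransport (m p.1) p.2 := by
  refine measurable_of_Iic fun t => ?_
  have : (fun p : α × ℝ => gaussianTransport (m p.1) p.2) ⁻¹' Iic t =
      {p | cdf (gaussianReal 0 1) p.2 ≤ cdf (m p.1) t} := by
    ext p; exact gaussianTransport_le_iff (h p.1) p.2 t
  rw [this]
  refine measurableSet_le ((monotone_cdf _).measurable.comp measurable_snd) ?_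
  simp_rw [cdf_eq_real]
  exact (hm t).ennreal_toReal.comp measurable_fst

/-- If `F` has a nonzero derivative at `q y₀` and `F ∘ q = id` near `y₀`, with `F` and `q`
monotone, then `q` is continuous at `y₀`. -/
lemma continuousAt_of_monotone_of_hasDerivAt {F q : ℝ → ℝ} {y₀ c : ℝ} (hF : Monotone F)
    (hd : HasDerivAt F c (q y₀)) (hc : c ≠ 0) (hq : ∀ᶠ y in 𝓝 y₀, F (q y) = y) :
    ContinuousAt q y₀ := by
  have h0 : F (q y₀) = y₀ := hq.self_of_nhds
  have hne := hd.eventually_ne hc (c := F (q y₀))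
  -- A nonzero derivative forbids a flat stretch of F next to `q y₀`, which is what a jump of q
  -- would require.
  have hlt : ∀ t, q y₀ < t → F (q y₀) < F t := by
    intro t ht
    have h1 : ∀ᶠ z in 𝓝[>] (q y₀), F z ≠ F (q y₀) := hne.filter_mono
      (nhdsWithin_mono _ fun z hz => ne_of_gt hz)
    obtain ⟨z, hz, hzt⟩ := (h1.and (Ioo_mem_nhdsGT ht)).exists
    exact (lt_of_le_of_ne (hF hzt.1.le) (Ne.symm hz)).trans_le (hF hzt.2.le)
  have hgt : ∀ t, t < q y₀ → F t < F (q y₀) := by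
    intro t ht
    have h1 : ∀ᶠ z in 𝓝[<] (q y₀), F z ≠ F (q y₀) := hne.filter_mono
      (nhdsWithin_mono _ fun z hz => ne_of_lt hz)
    obtain ⟨z, hz, hzt⟩ := (h1.and (Ioo_mem_nhdsLT ht)).exists
    exact (hF hzt.1.le).trans_lt (lt_of_le_of_ne (hF hzt.2.le) hz)
  refine tendsto_order.2 ⟨fun t ht => ?_, fun t ht => ?_⟩
  · have := hgt t ht
    rw [h0] at this
    filter_upwards [hq, lt_mem_nhds this] with y hy hty
    by_contra hc
    have := hF (not_lt.1 hc)
    rw [hy] at this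
    exact hty.not_ge this
  · have := hlt t ht
    rw [h0] at this
    filter_upwards [hq, gt_mem_nhds this] with y hy hty
    by_contra hc
    have := hF (not_lt.1 hc)
    rw [hy] at this
    exact hty.not_ge this

lemma ae_hasDerivAt_cdf_withDensity {f : ℝ → ℝ≥0∞} (hf : Measurable f)
    [IsProbabilityMeasure (volume.withDensity f)] :
    ∀ᵐ x, HasDerivAt (cdf (volume.withDensity f)) (f x).toReal x := by
  have h1 := (cdf (volume.withDensity f)).ae_hasDerivAt
  rw [measure_cdf] at h1
  filter_upwards [h1, Measure.rnDeriv_withDensity volume hf] with x hx hx'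
  rwa [hx'] at hx

lemma ae_hasDerivAt_cdf_gaussianReal :
    ∀ᵐ x, HasDerivAt (cdf (gaussianReal 0 1)) (gaussianPDFReal 0 1 x) x := by
  have h := gaussianReal_of_var_ne_zero 0 (one_ne_zero (α := NNReal))
  have : IsProbabilityMeasure (volume.withDensity (gaussianPDF 0 1)) := by
    rw [← h]; infer_instance
  have := ae_hasDerivAt_cdf_withDensity (measurable_gaussianPDF 0 1)
  rw [← h] at this
  simpa [toReal_gaussianPDF] using this

lemma ae_pos_lt_top_withDensity {α : Type*} [MeasurableSpace α] {μ : Measure α} {f : α → ℝ≥0∞}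
    (hf : Measurable f) (h : ∫⁻ x, f x ∂μ ≠ ∞) :
    ∀ᵐ x ∂μ.withDensity f, 0 < f x ∧ f x < ∞ := by
  rw [ae_withDensity_iff hf]
  filter_upwards [ae_lt_top hf h] with x hx h0
  exact ⟨pos_iff_ne_zero.2 h0, hx⟩

lemma withDensity_singleton (f : ℝ → ℝ≥0∞) (x : ℝ) : volume.withDensity f {x} = 0 :=
  withDensity_absolutelyContinuous _ _ Real.volume_singleton

/-- The chain rule and the inverse function rule apply where the cdf of the target has derivative f
with 0 < f < ∞. This holds almost everywhere for the target law, hence at the transported point for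
Gaussian-a.e. x, and so for Lebesgue-a.e. x since the Gaussian density is positive. -/
lemma ae_hasDerivAt_gaussianTransport {f : ℝ → ℝ≥0∞} (hf : Measurable f)
    [IsProbabilityMeasure (volume.withDensity f)] :
    ∀ᵐ x, HasDerivAt (gaussianTransport (volume.withDensity f))
      (gaussianPDFReal 0 1 x / (f (gaussianTransport (volume.withDensity f) x)).toReal) x := by
  set m := volume.withDensity f with hm
  have hint : ∫⁻ x, f x ≠ ∞ := by
    have : m univ = 1 := measure_univ
    rw [hm, withDensity_apply _ MeasurableSet.univ, Measure.restrict_univ] at this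
    rw [this]; exact ENNReal.one_ne_top
  have hs : ∀ x, m {x} = 0 := withDensity_singleton f
  have h1 : ∀ᵐ t ∂m, HasDerivAt (cdf m) (f t).toReal t ∧ 0 < f t ∧ f t < ∞ :=
    Filter.Eventually.and
      ((withDensity_absolutelyContinuous _ _).ae_le (ae_hasDerivAt_cdf_withDensity hf))
      (ae_pos_lt_top_withDensity hf hint)
  rw [← map_gaussianTransport hs] at h1
  have h2 := (gaussianReal_absolutelyContinuous' 0 one_ne_zero).ae_le
    (ae_of_ae_map (strictMono_gaussianTransport hs).monotone.measurable.aemeasurable h1)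
  filter_upwards [h2, ae_hasDerivAt_cdf_gaussianReal] with x hx hx'
  rw [map_gaussianTransport hs] at hx
  obtain ⟨hx1, hx2, hx3⟩ := hx
  have hpos : 0 < (f (gaussianTransport m x)).toReal := ENNReal.toReal_pos hx2.ne' hx3.ne
  have hq : ∀ᶠ y in 𝓝 (cdf (gaussianReal 0 1) x), cdf m (quantile m y) = y := by
    filter_upwards [isOpen_Ioo.mem_nhds (cdf_gaussianReal_mem_Ioo x)] with y hy
    exact cdf_quantile hs hy
  have hcont := continuousAt_of_monotone_of_hasDerivAt (q := quantile m)
    (monotone_cdf m) hx1 hpos.ne' hq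
  have := (HasDerivAt.of_local_left_inverse (g := quantile m) hcont hx1 hpos.ne' hq).comp x hx'
  rw [div_eq_inv_mul]
  exact this

end Quantile

/-! ### The standard Gaussian measure in n dimensions -/

/-- The standard Gaussian measure on `Fin n → ℝ`. -/
noncomputable def stdGaussianPi (n : ℕ) : Measure (Fin n → ℝ) :=
  Measure.pi fun _ => gaussianReal 0 1

/-- The density of the standard Gaussian measure on `Fin n → ℝ`. -/
noncomputable def stdGaussianPiPDF {n : ℕ} (x : Fin n → ℝ) : ℝ := ∏ i, gaussianPDFReal 0 1 (x i)

instance (n : ℕ) : IsProbabilityMeasure (stdGaussianPi n) := by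
  unfold stdGaussianPi; infer_instance

lemma stdGaussianPiPDF_pos {n : ℕ} (x : Fin n → ℝ) : 0 < stdGaussianPiPDF x :=
  Finset.prod_pos fun _ _ => gaussianPDFReal_pos _ _ _ one_ne_zero

lemma measurable_stdGaussianPiPDF {n : ℕ} :
    Measurable (stdGaussianPiPDF : (Fin n → ℝ) → ℝ) :=
  Finset.measurable_prod _ fun i _ =>
    (measurable_gaussianPDFReal 0 1).comp (measurable_pi_apply i)

lemma lintegral_stdGaussianPi {n : ℕ} {f : (Fin n → ℝ) → ℝ≥0∞} (hf : Measurable f) :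
    ∫⁻ x, f x ∂(stdGaussianPi n) = ∫⁻ x, ENNReal.ofReal (stdGaussianPiPDF x) * f x := by
  induction n with
  | zero =>
    simp only [stdGaussianPi, stdGaussianPiPDF, Finset.univ_eq_empty, Finset.prod_empty,
      ENNReal.ofReal_one, one_mul, volume_pi]
    rw [Measure.pi_of_empty, Measure.pi_of_empty]
  | succ n ih =>
    have hm : Measurable fun x => ENNReal.ofReal (stdGaussianPiPDF x) * f x :=
      measurable_stdGaussianPiPDF.ennreal_ofReal.mul hf
    rw [stdGaussianPi, lintegral_pi_snoc _ hf, volume_pi, lintegral_pi_snoc _ hm]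
    have := ih (f := fun y => ∫⁻ t, f (Fin.snoc (α := fun _ => ℝ) y t) ∂(gaussianReal 0 1))
      ((hf.comp measurable_snoc).lintegral_prod_right')
    refine this.trans (lintegral_congr fun y => ?_)
    have hfy : Measurable fun t => f (Fin.snoc (α := fun _ => ℝ) y t) :=
      hf.comp (measurable_snoc_right y)
    rw [gaussianReal_of_var_ne_zero 0 one_ne_zero, lintegral_withDensity_eq_lintegral_mul _
      (measurable_gaussianPDF 0 1) hfy,
      ← lintegral_const_mul' _ _ ENNReal.ofReal_ne_top]
    refine lintegral_congr fun t => ?_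
    simp only [stdGaussianPiPDF, Fin.prod_univ_castSucc, Fin.snoc_castSucc, Fin.snoc_last,
      Pi.mul_apply, gaussianPDF]
    rw [ENNReal.ofReal_mul (Finset.prod_nonneg fun _ _ => gaussianPDFReal_nonneg _ _ _), mul_assoc]

lemma stdGaussianPi_eq_withDensity (n : ℕ) :
    stdGaussianPi n = volume.withDensity fun x => ENNReal.ofReal (stdGaussianPiPDF x) := by
  ext s hs
  rw [withDensity_apply _ hs, ← lintegral_indicator_one hs,
    lintegral_stdGaussianPi (measurable_one.indicator hs), ← lintegral_indicator hs]
  refine lintegral_congr fun x => ?_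
  by_cases hx : x ∈ s <;> simp [hx]

lemma stdGaussianPi_absolutelyContinuous (n : ℕ) :
    stdGaussianPi n ≪ (volume : Measure (Fin n → ℝ)) := by
  rw [stdGaussianPi_eq_withDensity]; exact withDensity_absolutelyContinuous _ _

lemma absolutelyContinuous_stdGaussianPi (n : ℕ) :
    (volume : Measure (Fin n → ℝ)) ≪ stdGaussianPi n := by
  rw [stdGaussianPi_eq_withDensity]
  exact withDensity_absolutelyContinuous' measurable_stdGaussianPiPDF.ennreal_ofReal.aemeasurable
    (Filter.Eventually.of_forall fun x => (ENNReal.ofReal_pos.2 (stdGaussianPiPDF_pos x)).ne')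

/-! ### Conditional densities and existence of triangular transport -/

/-- The conditional density of the last coordinate given the others; it is the standard Gaussian
density where the marginal density vanishes or is infinite. -/
noncomputable def condDensity {n : ℕ} (f : (Fin (n + 1) → ℝ) → ℝ≥0∞) (y : Fin n → ℝ) (t : ℝ) :
    ℝ≥0∞ :=
  open scoped Classical in
  if 0 < ∫⁻ u, f (Fin.snoc (α := fun _ => ℝ) y u) ∧
      ∫⁻ u, f (Fin.snoc (α := fun _ => ℝ) y u) < ∞ then
    f (Fin.snoc (α := fun _ => ℝ) y t) / ∫⁻ u, f (Fin.snoc (α := fun _ => ℝ) y u)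
  else gaussianPDF 0 1 t

section CondDensity

variable {n : ℕ} {f : (Fin (n + 1) → ℝ) → ℝ≥0∞}

lemma measurable_marginal (hf : Measurable f) :
    Measurable fun y : Fin n → ℝ => ∫⁻ u, f (Fin.snoc (α := fun _ => ℝ) y u) :=
  (hf.comp measurable_snoc).lintegral_prod_right'

lemma measurable_condDensity (hf : Measurable f) :
    Measurable fun p : (Fin n → ℝ) × ℝ => condDensity f p.1 p.2 := by
  have h : Measurable fun p : (Fin n → ℝ) × ℝ =>
      ∫⁻ u, f (Fin.snoc (α := fun _ => ℝ) p.1 u) := (measurable_marginal hf).comp measurable_fst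
  refine Measurable.ite ?_ ((hf.comp measurable_snoc).div h)
    ((measurable_gaussianPDF 0 1).comp measurable_snd)
  exact (measurableSet_lt measurable_const h).inter (measurableSet_lt h measurable_const)

lemma lintegral_condDensity (hf : Measurable f) (y : Fin n → ℝ) :
    ∫⁻ t, condDensity f y t = 1 := by
  unfold condDensity
  split_ifs with h
  · simp_rw [div_eq_mul_inv]
    have hfy : Measurable fun t => f (Fin.snoc (α := fun _ => ℝ) y t) :=
      hf.comp (measurable_snoc_right y)
    rw [lintegral_mul_const _ hfy]
    exact ENNReal.mul_inv_cancel h.1.ne' h.2.ne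
  · exact lintegral_gaussianPDF_eq_one 0 one_ne_zero

lemma marginal_mul_condDensity (y : Fin n → ℝ) (t : ℝ)
    (h : 0 < ∫⁻ u, f (Fin.snoc (α := fun _ => ℝ) y u))
    (h' : ∫⁻ u, f (Fin.snoc (α := fun _ => ℝ) y u) < ∞) :
    (∫⁻ u, f (Fin.snoc (α := fun _ => ℝ) y u)) * condDensity f y t =
      f (Fin.snoc (α := fun _ => ℝ) y t) := by
  rw [condDensity, if_pos ⟨h, h'⟩, ENNReal.mul_div_cancel h.ne' h'.ne]

instance isProbabilityMeasure_condDensity [hf : Fact (Measurable f)] (y : Fin n → ℝ) :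
    IsProbabilityMeasure (volume.withDensity (condDensity f y)) :=
  ⟨by rw [withDensity_apply _ MeasurableSet.univ, Measure.restrict_univ,
    lintegral_condDensity hf.out]⟩

end CondDensity

lemma measurable_left_of_init {n : ℕ} {β : Type*} [MeasurableSpace β] {g : (Fin n → ℝ) × ℝ → β}
    (hg : Measurable g) :
    Measurable fun x : Fin (n + 1) → ℝ => g (Fin.init x, x (Fin.last n)) :=
  hg.comp (measurable_init.prodMk (measurable_pi_apply _))

/-- The triangular transport of the standard Gaussian measure to a measure with a density, together
with the associated Jacobian equation. -/
theorem exists_triangular_transport {n : ℕ} {f : (Fin n → ℝ) → ℝ≥0∞} (hf : Measurable f)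
    (hf1 : ∫⁻ x, f x = 1) :
    ∃ (T : (Fin n → ℝ) → (Fin n → ℝ)) (d : Fin n → (Fin n → ℝ) → ℝ),
      HasTriangularDeriv T d ∧ (stdGaussianPi n).map T = volume.withDensity f ∧
      ∀ᵐ x ∂(stdGaussianPi n), (f (T x)).toReal * ∏ i, d i x = stdGaussianPiPDF x := by
  induction n with
  | zero =>
    refine ⟨id, fun i => i.elim0, ⟨measurable_id, fun i => i.elim0, fun i => i.elim0,
      fun i => i.elim0, fun i => i.elim0, fun i => i.elim0⟩, ?_, ?_⟩
    · have h0 : ∀ x, f x = 1 := by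
        intro x
        rw [volume_pi, Measure.pi_of_empty (x := x), lintegral_dirac] at hf1
        exact hf1
      have : f = 1 := funext h0
      rw [Measure.map_id, this, withDensity_one, stdGaussianPi, volume_pi, Measure.pi_of_empty,
        Measure.pi_of_empty]
    · refine Filter.Eventually.of_forall fun x => ?_
      rw [volume_pi, Measure.pi_of_empty (x := x), lintegral_dirac] at hf1
      simp [stdGaussianPiPDF, hf1]
  | succ n ih =>
    have : Fact (Measurable f) := ⟨hf⟩
    set f' : (Fin n → ℝ) → ℝ≥0∞ := fun y => ∫⁻ u, f (Fin.snoc (α := fun _ => ℝ) y u) with hf'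
    have hf'm : Measurable f' := measurable_marginal hf
    have hf'1 : ∫⁻ y, f' y = 1 := by
      rw [← hf1, volume_pi, volume_pi, lintegral_pi_snoc _ hf]
    obtain ⟨T', d', hT', hmap, hjac⟩ := ih hf'm hf'1
    set m : (Fin n → ℝ) → Measure ℝ := fun y => volume.withDensity (condDensity f y) with hmdef
    have hm0 : ∀ y x, m y {x} = 0 := fun y x => withDensity_singleton _ x
    have hcm := measurable_condDensity hf
    have hcy : ∀ y, Measurable (condDensity f y) := fun y => hcm.comp measurable_prodMk_left
    have hτm : Measurable fun p : (Fin n → ℝ) × ℝ => gaussianTransport (m p.1) p.2 := by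
      refine measurable_gaussianTransport hm0 fun t => ?_
      simp only [hmdef]
      simp_rw [withDensity_apply _ measurableSet_Iic]
      exact hcm.lintegral_prod_right'
    set τ : (Fin n → ℝ) → ℝ → ℝ := fun y t => gaussianTransport (m y) t with hτ
    set j : (Fin n → ℝ) → ℝ → ℝ := fun y t =>
      gaussianPDFReal 0 1 t / (condDensity f y (τ y t)).toReal with hj
    have hjm : Measurable fun p : (Fin n → ℝ) × ℝ => j p.1 p.2 :=
      ((measurable_gaussianPDFReal 0 1).comp measurable_snd).div
        (hcm.comp (measurable_fst.prodMk hτm)).ennreal_toReal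
    -- The last coordinate is sent to the conditional law given the already transported coordinates
    -- `T' (Fin.init x)`, not given `Fin.init x`.
    set T : (Fin (n + 1) → ℝ) → (Fin (n + 1) → ℝ) := fun x =>
      Fin.snoc (α := fun _ => ℝ) (T' (Fin.init x)) (τ (T' (Fin.init x)) (x (Fin.last n))) with hT
    set d : Fin (n + 1) → (Fin (n + 1) → ℝ) → ℝ := fun i x =>
      Fin.lastCases (motive := fun _ => ℝ) (j (T' (Fin.init x)) (x (Fin.last n)))
        (fun k => d' k (Fin.init x)) i with hd
    have hdl : ∀ x, d (Fin.last n) x = j (T' (Fin.init x)) (x (Fin.last n)) := fun x => by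
      simp [hd]
    have hdc : ∀ (k : Fin n) x, d k.castSucc x = d' k (Fin.init x) := fun k x => by simp [hd]
    have hT'm : Measurable fun p : (Fin n → ℝ) × ℝ => (T' p.1, p.2) :=
      (hT'.measurable.comp measurable_fst).prodMk measurable_snd
    have hTm : Measurable T :=
      measurable_snoc.comp ((hT'.measurable.comp measurable_init).prodMk
        (measurable_left_of_init (hτm.comp hT'm)))
    have hint : ∀ {i : Fin n} {x y : Fin (n + 1) → ℝ}, (∀ j < i.castSucc, x j = y j) →
        ∀ j < i, Fin.init x j = Fin.init y j := fun h j hj => h _ (by simpa using hj)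
    have hinit : ∀ {x y : Fin (n + 1) → ℝ}, (∀ j < Fin.last n, x j = y j) →
        (Fin.init x : Fin n → ℝ) = Fin.init y := fun h => funext fun j => h _ (Fin.castSucc_lt_last j)
    have hTder : HasTriangularDeriv T d := by
      refine ⟨hTm, ?_, ?_, ?_, ?_, ?_⟩
      · intro i
        refine Fin.lastCases (fun x y h => ?_) (fun k x y h => ?_) i
        · simp only [hT, Fin.snoc_last]
          rw [hinit h]
          exact (strictMono_gaussianTransport (hm0 _)).le_iff_le.symm
        · simpa [hT, Fin.init] using hT'.triangular k (Fin.init x) (Fin.init y) (hint h)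
      · intro i
        refine Fin.lastCases ?_ (fun k => ?_) i
        · rw [funext hdl]
          exact measurable_left_of_init (hjm.comp hT'm)
        · rw [funext (hdc k)]
          exact (hT'.measurable_deriv k).comp measurable_init
      · intro i x
        refine Fin.lastCases ?_ (fun k => ?_) i
        · rw [hdl]
          exact div_nonneg (gaussianPDFReal_nonneg _ _ _) ENNReal.toReal_nonneg
        · rw [hdc]
          exact hT'.nonneg _ _
      · intro i
        refine Fin.lastCases (fun x y h => ?_) (fun k x y h => ?_) i
        · rw [hdl, hdl, hinit fun j hj => h j hj.le, h _ le_rfl]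
        · rw [hdc, hdc]
          exact hT'.congr k _ _ fun j hj => h _ (by simpa using hj)
      · intro i
        refine Fin.lastCases (fun x => ?_) (fun k x => ?_) i
        · have hi : ∀ t, (Fin.init (Function.update x (Fin.last n) t) : Fin n → ℝ) = Fin.init x :=
            fun t => Fin.init_update_last _ _
          simp only [hT, hdl, Fin.snoc_last, hi, Function.update_self]
          exact ae_hasDerivAt_gaussianTransport (hcy _)
        · have hi : ∀ t, (Fin.init (Function.update x k.castSucc t) : Fin n → ℝ) =
            Function.update (Fin.init x) k t := fun t => Fin.init_update_castSucc _ _ _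
          simp only [hT, hdc, Fin.snoc_castSucc, hi]
          exact hT'.hasDerivAt k _
    have hτmap : ∀ y, (gaussianReal 0 1).map (τ y) = m y := fun y => map_gaussianTransport (hm0 y)
    have hτy : ∀ y, Measurable (τ y) := fun y =>
      (strictMono_gaussianTransport (hm0 y)).monotone.measurable
    have hfin : ∀ᵐ y, f' y < ∞ := ae_lt_top hf'm (by rw [hf'1]; exact ENNReal.one_ne_top)
    refine ⟨T, d, hTder, ?_, ?_⟩
    · refine Measure.ext_of_lintegral _ fun ψ hψ => ?_
      have hψT : Measurable fun x => ψ (T x) := hψ.comp hTm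
      rw [lintegral_map hψ hTm, stdGaussianPi, lintegral_pi_snoc _ hψT,
        lintegral_withDensity_eq_lintegral_mul _ hf hψ, volume_pi,
        lintegral_pi_snoc _ (hf.mul hψ)]
      have hψy : ∀ y, Measurable fun t => ψ (Fin.snoc (α := fun _ => ℝ) y t) := fun y =>
        hψ.comp (measurable_snoc_right y)
      set G : (Fin n → ℝ) → ℝ≥0∞ := fun y =>
        ∫⁻ t, condDensity f y t * ψ (Fin.snoc (α := fun _ => ℝ) y t) with hG
      have hGm : Measurable G := (hcm.mul (hψ.comp measurable_snoc)).lintegral_prod_right'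
      have e1 : ∀ y, ∫⁻ t, ψ (T (Fin.snoc (α := fun _ => ℝ) y t)) ∂(gaussianReal 0 1) =
          G (T' y) := by
        intro y
        simp only [hT, Fin.init_snoc, Fin.snoc_last]
        rw [← lintegral_map (μ := gaussianReal 0 1) (g := τ (T' y))
          (f := fun t => ψ (Fin.snoc (α := fun _ => ℝ) (T' y) t))
          (hψy _) (hτy _), hτmap,
          lintegral_withDensity_eq_lintegral_mul _ (hcy _) (hψy _)]
        rfl
      simp_rw [e1]
      change ∫⁻ y, G (T' y) ∂(stdGaussianPi n) = _
      rw [← lintegral_map hGm hT'.measurable, hmap,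
        lintegral_withDensity_eq_lintegral_mul _ hf'm hGm]
      refine lintegral_congr_ae ?_
      filter_upwards [hfin] with y hy
      simp only [Pi.mul_apply]
      -- Where the marginal vanishes the conditional density has its Gaussian default, but f then
      -- vanishes a.e. on the fibre and both sides are 0.
      rcases eq_or_ne (f' y) 0 with h0 | h0
      · rw [h0, zero_mul]
        have := (lintegral_eq_zero_iff (hf.comp (measurable_snoc_right y))).1 h0
        symm
        refine lintegral_eq_zero_of_ae_eq_zero ?_
        filter_upwards [this] with t ht
        simp only [Function.comp, Pi.zero_apply] at ht
        simp [ht]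
      · rw [hG, ← lintegral_const_mul' _ _ hy.ne]
        refine lintegral_congr fun t => ?_
        rw [← mul_assoc, marginal_mul_condDensity y t (pos_iff_ne_zero.2 h0) hy]
    · have hpos : ∀ᵐ y ∂(stdGaussianPi n), 0 < f' (T' y) ∧ f' (T' y) < ∞ := by
        have := ae_pos_lt_top_withDensity hf'm (by rw [hf'1]; exact ENNReal.one_ne_top)
        rw [← hmap] at this
        exact ae_of_ae_map hT'.measurable.aemeasurable this
      have hcpos : ∀ y, ∀ᵐ t ∂(gaussianReal 0 1), 0 < condDensity f y (τ y t) ∧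
          condDensity f y (τ y t) < ∞ := by
        intro y
        have := ae_pos_lt_top_withDensity (hcy y)
          (by rw [lintegral_condDensity hf y]; exact ENNReal.one_ne_top)
        change ∀ᵐ t ∂(m y), _ at this
        rw [← hτmap y] at this
        exact ae_of_ae_map (hτy y).aemeasurable this
      have hset : MeasurableSet {x | (f (T x)).toReal * ∏ i, d i x = stdGaussianPiPDF x} :=
        measurableSet_eq_fun ((hf.comp hTm).ennreal_toReal.mul
          (Finset.measurable_prod _ fun i _ => hTder.measurable_deriv i))
          measurable_stdGaussianPiPDF
      unfold stdGaussianPi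
      rw [← (measurePreserving_snocEquiv n (gaussianReal 0 1)).map_eq]
      refine (ae_map_iff (snocEquiv n).measurable.aemeasurable hset).2 ?_
      refine (Measure.ae_prod_iff_ae_ae ((snocEquiv n).measurable hset)).2 ?_
      filter_upwards [hpos, hjac] with y hy hyj
      filter_upwards [hcpos (T' y)] with t ht
      have hct : (condDensity f (T' y) (τ (T' y) t)).toReal ≠ 0 :=
        (ENNReal.toReal_pos ht.1.ne' ht.2.ne).ne'
      simp only [snocEquiv_apply, Fin.prod_univ_castSucc, hdl, hdc, Fin.init_snoc, Fin.snoc_last,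
        stdGaussianPiPDF, hT, Fin.snoc_castSucc, hj]
      -- Marginal times conditional density: the marginal factor is handled by the Jacobian equation
      -- in dimension n, and the conditional one cancels the denominator of the last derivative.
      rw [← marginal_mul_condDensity (T' y) _ hy.1 hy.2, ENNReal.toReal_mul]
      change _ = stdGaussianPiPDF y * _
      rw [← hyj]
      simp only [hf']
      field_simp

/-! ### Almost everywhere affine maps and Pexider's equation -/

lemma ae_add_right_iff {E : Type*} [NormedAddCommGroup E] [MeasurableSpace E] [BorelSpace E]
    [SecondCountableTopology E] {μ : Measure E} [μ.IsAddRightInvariant] {p : E → Prop} (h : E) : (∀ᵐ x ∂μ, p (x + h)) ↔ ∀ᵐ x ∂μ, p x := by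
  constructor
  · intro hp
    have := (measurePreserving_add_right μ (-h)).quasiMeasurePreserving.ae hp
    simpa using this
  · intro hp
    exact (measurePreserving_add_right μ h).quasiMeasurePreserving.ae hp

section Increments

open scoped Pointwise

variable {E : Type*} [NormedAddCommGroup E] [NormedSpace ℝ E] [FiniteDimensional ℝ E]
  [MeasurableSpace E] [BorelSpace E] {μ : Measure E} [μ.IsAddHaarMeasure]

/-- A measurable function whose increments are almost everywhere constant is almost everywhere
affine. -/
theorem ae_eq_affine_of_increments {T c : E → E} (hT : Measurable T)
    (h : ∀ k, ∀ᵐ x ∂μ, T (x + k) = T x + c k) :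
    ∃ (L : E →L[ℝ] E) (t : E), (∀ k, c k = L k) ∧ ∀ᵐ x ∂μ, T x = L x + t := by
  have hadd : ∀ k l, c (k + l) = c k + c l := by
    intro k l
    obtain ⟨x, h1, h2, h3⟩ := ((h (k + l)).and ((h k).and ((ae_add_right_iff k).2 (h l)))).exists
    rw [← add_assoc, h3, h2, add_assoc] at h1
    exact (add_left_cancel h1).symm
  let c' : E →+ E := AddMonoidHom.mk' c hadd
  -- Steinhaus argument: a compact K of positive measure on which T is bounded by N meets its small
  -- translates in positive measure, so c is bounded by 2N near 0. A locally bounded additive map is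
  -- continuous and linear.
  obtain ⟨N, hN⟩ : ∃ N : ℕ, μ {x | ‖T x‖ ≤ N} ≠ 0 := by
    by_contra! hc
    have h1 := measure_iUnion_null hc
    have h2 : ⋃ N : ℕ, {x | ‖T x‖ ≤ N} = Set.univ :=
      Set.eq_univ_of_forall fun x => Set.mem_iUnion.2 (exists_nat_ge ‖T x‖)
    rw [h2] at h1
    exact (NeZero.ne μ) (Measure.measure_univ_eq_zero.1 h1)
  have hNm : MeasurableSet {x | ‖T x‖ ≤ N} := measurableSet_le hT.norm measurable_const
  obtain ⟨K, hKN, hK, hK0⟩ := hNm.exists_lt_isCompact (pos_iff_ne_zero.2 hN)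
  have hev := eventually_nhds_zero_measure_vadd_sdiff_lt (μ := μ) hK hK.isClosed hK0.ne'
  have hbound : ∀ᶠ g in nhds (0 : E), ‖c g‖ ≤ 2 * N := by
    filter_upwards [hev] with g hg
    have hne : μ ((g +ᵥ K) ∩ K) ≠ 0 := by
      intro h0
      have h1 := measure_inter_add_sdiff (μ := μ) (g +ᵥ K) hK.measurableSet
      rw [h0, zero_add, measure_vadd] at h1
      exact hg.ne h1
    have hae : ∀ᵐ y ∂μ, T y = T (y + -g) + c g := by
      have := (ae_add_right_iff (-g)).2 (h g)
      simpa using this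
    obtain ⟨y, ⟨hy1, hy2⟩, hy⟩ := ((frequently_ae_mem_iff.2 hne).and_eventually hae).exists
    obtain ⟨x, hx, rfl⟩ := hy1
    have hxN : ‖T x‖ ≤ N := hKN hx
    have hyN : ‖T (g + x)‖ ≤ N := hKN hy2
    have hgx : g + x + -g = x := by abel
    simp only [vadd_eq_add] at hy
    rw [hgx] at hy
    have : c g = T (g + x) - T x := by rw [hy]; abel
    rw [this]
    exact (norm_sub_le _ _).trans (by linarith)
  have hcont : Continuous c' := c'.continuous_of_isBounded_nhds_zero hbound
    (Metric.isBounded_closedBall (x := (0 : E)) (r := 2 * N) |>.subset (by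
      rintro _ ⟨g, hg, rfl⟩
      exact mem_closedBall_zero_iff.2 hg))
  let L : E →L[ℝ] E := c'.toRealLinearMap hcont
  have hL : ∀ k, c k = L k := fun k => rfl
  have hG : Measurable fun x => T x - L x := hT.sub L.measurable
  -- The exceptional set depends on the shift; Fubini exchanges the quantifiers so that one base
  -- point serves almost all shifts.
  have hswap : ∀ᵐ x ∂μ, ∀ᵐ k ∂μ, T (x + k) - L (x + k) = T x - L x := by
    refine (Measure.ae_ae_comm ?_).1 (Filter.Eventually.of_forall fun k => ?_)
    · exact measurableSet_eq_fun (hG.comp (measurable_snd.add measurable_fst))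
        (hG.comp measurable_snd)
    · filter_upwards [h k] with x hx
      rw [hx, hL, map_add]; abel
  obtain ⟨x₀, hx₀⟩ := hswap.exists
  refine ⟨L, T x₀ - L x₀, hL, ?_⟩
  have h1 : ∀ᵐ k ∂μ, T (k + x₀) - L (k + x₀) = T x₀ - L x₀ := by simpa [add_comm] using hx₀
  filter_upwards [(ae_add_right_iff (p := fun y => T y - L y = T x₀ - L x₀) x₀).1 h1] with x hx
  rw [← hx]; abel

/-- Measurable almost everywhere solutions of Pexider's equation `a T(x) + b U(y) = S(a x + b y)`
are affine. -/
theorem ae_eq_affine_of_pexider {T U S : E → E} (hT : Measurable T) (hU : Measurable U) {a b : ℝ}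
    (ha : a ≠ 0) (hb : b ≠ 0)
    (h : ∀ᵐ z ∂(μ.prod μ), a • T z.1 + b • U z.2 = S (a • z.1 + b • z.2)) :
    ∃ (L : E →L[ℝ] E) (t u : E), (∀ᵐ x ∂μ, T x = L x + t) ∧ ∀ᵐ y ∂μ, U y = L y + u := by
  -- Shifting (x, y) by (bk, -ak) leaves ax + by fixed, which eliminates S. Freezing y then makes
  -- the increments of T constant.
  have key : ∀ k, ∀ᵐ z ∂(μ.prod μ),
      a • (T (z.1 + b • k) - T z.1) = b • (U z.2 - U (z.2 + -(a • k))) := by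
    intro k
    have h2 := (ae_add_right_iff (μ := μ.prod μ) (b • k, -(a • k))).2 h
    filter_upwards [h, h2] with z hz hz2
    simp only [Prod.fst_add, Prod.snd_add] at hz2
    have e : a • (z.1 + b • k) + b • (z.2 + -(a • k)) = a • z.1 + b • z.2 := by
      module
    rw [e, ← hz] at hz2
    rw [smul_sub, smul_sub, sub_eq_sub_iff_add_eq_add, hz2]
    abel
  have hTk : ∀ k, ∃ c, ∀ᵐ x ∂μ, T (x + k) = T x + c := by
    intro k
    have h1 := key (b⁻¹ • k)
    have h2 := (Measure.measurePreserving_swap (μ := μ) (ν := μ)).quasiMeasurePreserving.ae h1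
    obtain ⟨y, hy⟩ := (Measure.ae_ae_of_ae_prod h2).exists
    refine ⟨a⁻¹ • b • (U y - U (y + -(a • b⁻¹ • k))), ?_⟩
    filter_upwards [hy] with x hx
    simp only [Prod.fst_swap, Prod.snd_swap, smul_inv_smul₀ hb] at hx
    rw [← hx, inv_smul_smul₀ ha]
    abel
  choose c hc using hTk
  obtain ⟨L, t, hL, hTL⟩ := ae_eq_affine_of_increments hT hc
  -- Freezing x instead shows that U has the same increments L, whence the common linear part.
  have hUk : ∀ k, ∀ᵐ y ∂μ, U (y + k) = U y + L k := by
    intro k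
    obtain ⟨x, hx, hx'⟩ := ((Measure.ae_ae_of_ae_prod (key (a⁻¹ • k))).and
      (hc (b • a⁻¹ • k))).exists
    have h1 : ∀ᵐ y ∂μ, U y = U (y + -k) + L k := by
      filter_upwards [hx] with y hy
      simp only [smul_inv_smul₀ ha] at hy
      rw [hx', hL, add_sub_cancel_left, map_smul, map_smul, smul_comm b, smul_inv_smul₀ ha] at hy
      rw [smul_right_injective E hb hy]
      abel
    have := (ae_add_right_iff k).2 h1
    simpa using this
  obtain ⟨L', u, hL', hUL⟩ := ae_eq_affine_of_increments hU hUk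
  refine ⟨L, t, u, hTL, ?_⟩
  filter_upwards [hUL] with y hy
  rw [hy, hL']

end Increments

/-! ### Stability of triangular maps under scaling, affine substitution and sums -/

namespace HasTriangularDeriv

variable {n : ℕ} {s r : (Fin n → ℝ) → (Fin n → ℝ)} {d e : Fin n → (Fin n → ℝ) → ℝ}

lemma const_smul (h : HasTriangularDeriv s d) {c : ℝ} (hc : 0 < c) :
    HasTriangularDeriv (fun x => c • s x) (fun i x => c * d i x) where
  measurable := h.measurable.const_smul c
  triangular i x y hxy := by
    simpa [mul_le_mul_iff_right₀ hc] using h.triangular i x y hxy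
  measurable_deriv i := (h.measurable_deriv i).const_mul c
  nonneg i x := mul_nonneg hc.le (h.nonneg i x)
  congr i x y hxy := by rw [h.congr i x y hxy]
  hasDerivAt i x := by
    filter_upwards [h.hasDerivAt i x] with t ht
    exact ht.const_mul c

lemma comp_affine (h : HasTriangularDeriv s d) {c : ℝ} (hc : 0 < c) (v : Fin n → ℝ) :
    HasTriangularDeriv (fun x => s (c • x + v)) (fun i x => c * d i (c • x + v)) where
  measurable := h.measurable.comp ((measurable_id.const_smul c).add_const v)
  triangular i x y hxy := by
    rw [← h.triangular i (c • x + v) (c • y + v) fun j hj => by simp [hxy j hj]]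
    simp [mul_le_mul_iff_right₀ hc]
  measurable_deriv i := ((h.measurable_deriv i).comp
    ((measurable_id.const_smul c).add_const v)).const_mul c
  nonneg i x := mul_nonneg hc.le (h.nonneg i _)
  congr i x y hxy := by
    rw [h.congr i (c • x + v) (c • y + v) fun j hj => by simp [hxy j hj]]
  hasDerivAt i x := by
    have h1 := h.hasDerivAt i (c • x + v)
    have e : ∀ t, c • Function.update x i t + v = Function.update (c • x + v) i (c * t + v i) := by
      intro t
      ext j
      rcases eq_or_ne j i with rfl | hj
      · simp
      · simp [hj]
    have hq : ∀ᵐ t : ℝ, HasDerivAt (fun t => s (Function.update (c • x + v) i t) i)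
        (d i (Function.update (c • x + v) i (c * t + v i))) (c * t + v i) := by
      have h2 := (measurePreserving_add_right (volume : Measure ℝ) (v i)).quasiMeasurePreserving
      have h3 := (ae_add_right_iff (μ := (volume : Measure ℝ)) (v i)).2 h1
      -- The substitution t ↦ ct + vᵢ pulls null sets back to null sets, so differentiability almost
      -- everywhere survives it.
      have h4 : Measure.QuasiMeasurePreserving (fun t : ℝ => c * t) volume volume := by
        refine ⟨measurable_const_mul c, ?_⟩
        rw [Real.map_volume_mul_left hc.ne']
        exact Measure.smul_absolutelyContinuous
      exact h4.ae h3
    filter_upwards [hq] with t ht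
    simp_rw [e]
    have h5 : HasDerivAt (fun t : ℝ => c * t + v i) c t := by
      simpa using ((hasDerivAt_id t).const_mul c).add_const (v i)
    have := HasDerivAt.comp t ht h5
    rw [mul_comm]
    exact this

lemma add (hs : HasTriangularDeriv s d) (hr : HasTriangularDeriv r e) :
    HasTriangularDeriv (fun x => s x + r x) (fun i x => d i x + e i x) where
  measurable := hs.measurable.add hr.measurable
  triangular i x y hxy := by
    have h1 := hs.triangular i x y hxy
    have h2 := hr.triangular i x y hxy
    have h3 := hs.triangular i y x fun j hj => (hxy j hj).symm
    have h4 := hr.triangular i y x fun j hj => (hxy j hj).symm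
    simp only [Pi.add_apply]
    constructor
    · intro h
      exact add_le_add (h1.1 h) (h2.1 h)
    · intro h
      by_contra hc
      have hlt := not_le.1 hc
      exact absurd h (not_le.2 (add_lt_add (lt_of_not_ge fun h' => hc (h1.2 h'))
        (lt_of_not_ge fun h' => hc (h2.2 h'))))
  measurable_deriv i := (hs.measurable_deriv i).add (hr.measurable_deriv i)
  nonneg i x := add_nonneg (hs.nonneg i x) (hr.nonneg i x)
  congr i x y hxy := by rw [hs.congr i x y hxy, hr.congr i x y hxy]
  hasDerivAt i x := by
    filter_upwards [hs.hasDerivAt i x, hr.hasDerivAt i x] with t h1 h2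
    exact h1.add h2

end HasTriangularDeriv

/-! ### Rotation invariance and the logarithm of the Gaussian density -/

lemma stdGaussianPi_map_toLp (n : ℕ) :
    (stdGaussianPi n).map (WithLp.toLp 2) = stdGaussian (EuclideanSpace ℝ (Fin n)) :=
  map_pi_eq_stdGaussian

lemma stdGaussianPi_eq_map (n : ℕ) :
    stdGaussianPi n = (stdGaussian (EuclideanSpace ℝ (Fin n))).map
      (EuclideanSpace.equiv (Fin n) ℝ) := by
  rw [← stdGaussianPi_map_toLp, Measure.map_map (by fun_prop) (by fun_prop)]
  exact Measure.map_id.symm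

instance isGaussian_stdGaussianPi (n : ℕ) : IsGaussian (stdGaussianPi n) := by
  rw [stdGaussianPi_eq_map]
  infer_instance

lemma integral_id_stdGaussianPi (n : ℕ) : ∫ x, id x ∂(stdGaussianPi n) = 0 := by
  rw [stdGaussianPi_eq_map, integral_map (by fun_prop) (by fun_prop)]
  have := (EuclideanSpace.equiv (Fin n) ℝ).toContinuousLinearMap.integral_comp_id_comm
    (IsGaussian.integrable_id (μ := stdGaussian (EuclideanSpace ℝ (Fin n))))
  simp only [id]
  refine this.trans ?_
  rw [integral_id_stdGaussian, map_zero]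

/-- Rotation invariance of the product of two standard Gaussian measures. -/
lemma measurePreserving_rotation_stdGaussianPi (n : ℕ) {a b : ℝ} (ha : 0 ≤ a) (hb : 0 ≤ b)
    (hab : a ^ 2 + b ^ 2 = 1) :
    MeasurePreserving (fun z : (Fin n → ℝ) × (Fin n → ℝ) =>
        (a • z.1 + -(b • z.2), b • z.1 + a • z.2))
      ((stdGaussianPi n).prod (stdGaussianPi n)) ((stdGaussianPi n).prod (stdGaussianPi n)) := by
  refine ⟨by fun_prop, ?_⟩
  -- The angle has cosine a and sine -b.
  have h := IsGaussian.map_rotation_eq_self (integral_id_stdGaussianPi n) (-Real.arccos a)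
  have hsin : Real.sin (Real.arccos a) = b := by
    rw [Real.sin_arccos, ← hab, add_sub_cancel_left, Real.sqrt_sq hb]
  have hcos : Real.cos (Real.arccos a) = a :=
    Real.cos_arccos (by linarith) (by nlinarith)
  convert h using 2
  ext z : 1
  simp [ContinuousLinearMap.rotation_apply, hsin, hcos]

/-- Integrability of `log φ` for the standard Gaussian density `φ`. -/
lemma integrable_log_stdGaussianPiPDF (n : ℕ) :
    Integrable (fun x : Fin n → ℝ => Real.log (stdGaussianPiPDF x)) (stdGaussianPi n) := by
  have h : ∀ x : Fin n → ℝ, Real.log (stdGaussianPiPDF x) =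
      ∑ i, (-Real.log (√(2 * Real.pi)) - x i ^ 2 / 2) := by
    intro x
    rw [stdGaussianPiPDF, Real.log_prod fun i _ => (gaussianPDFReal_pos _ _ _ one_ne_zero).ne']
    refine Finset.sum_congr rfl fun i _ => ?_
    have hpi : 0 < √(2 * Real.pi) := Real.sqrt_pos.2 (by positivity)
    rw [gaussianPDFReal, Real.log_mul (by simpa using hpi.ne') (Real.exp_pos _).ne', Real.log_exp,
      Real.log_inv]
    simp
    ring
  simp_rw [h]
  refine integrable_finsetSum _ fun i _ => (integrable_const _).sub (Integrable.div_const ?_ 2)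
  have h2 : MemLp (fun x : ℝ => x) 2 (gaussianReal 0 1) := memLp_id_gaussianReal 2
  exact (measurePreserving_eval (fun _ : Fin n => gaussianReal 0 1) i).integrable_comp_of_integrable
    h2.integrable_sq

/-! ### The two convexity inequalities and the interpolated map -/

/-- Equality case of `∫ r ≤ log ∫ exp r`, for `∫ r = 0`. -/
lemma ae_eq_zero_of_lintegral_exp_le_one {α : Type*} [MeasurableSpace α] {μ : Measure α}
    [IsProbabilityMeasure μ] {r : α → ℝ} (hr : Integrable r μ) (h0 : ∫ x, r x ∂μ = 0)
    (h1 : ∫⁻ x, ENNReal.ofReal (Real.exp (r x)) ∂μ ≤ 1) : r =ᵐ[μ] 0 := by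
  have hexp : Integrable (fun x => Real.exp (r x)) μ := by
    refine ⟨Real.continuous_exp.comp_aestronglyMeasurable hr.1, ?_⟩
    rw [hasFiniteIntegral_iff_ofReal (Filter.Eventually.of_forall fun x => (Real.exp_pos _).le)]
    exact h1.trans_lt ENNReal.one_lt_top
  have hle : ∫ x, Real.exp (r x) ∂μ ≤ 1 := by
    rw [integral_eq_lintegral_of_nonneg_ae
      (Filter.Eventually.of_forall fun x => (Real.exp_pos _).le) hexp.1]
    exact ENNReal.toReal_le_of_le_ofReal zero_le_one (by simpa using h1)
  -- A nonnegative function with integral at most 0; it vanishes only where r does.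
  have hnn : ∀ x, 0 ≤ Real.exp (r x) - 1 - r x := fun x => by
    linarith [Real.add_one_le_exp (r x)]
  have he1 : Integrable (fun x => Real.exp (r x) - 1) μ := hexp.sub (integrable_const 1)
  have hint : Integrable (fun x => Real.exp (r x) - 1 - r x) μ := he1.sub hr
  have hI : ∫ x, (Real.exp (r x) - 1 - r x) ∂μ = 0 := by
    refine le_antisymm ?_ (integral_nonneg hnn)
    rw [integral_sub he1 hr, integral_sub hexp (integrable_const 1),
      h0]
    simpa using hle
  filter_upwards [(integral_eq_zero_iff_of_nonneg hnn hint).1 hI] with x hx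
  by_contra hne
  have := Real.add_one_lt_exp hne
  simp only [Pi.zero_apply] at hx
  linarith

/-- The weighted arithmetic-geometric mean inequality for products. -/
lemma prod_rpow_mul_prod_rpow_le {ι : Type*} (s : Finset ι) {u v : ι → ℝ} (hu : ∀ i, 0 ≤ u i)
    (hv : ∀ i, 0 ≤ v i) {p q : ℝ} (hp : 0 ≤ p) (hq : 0 ≤ q) (hpq : p + q = 1) :
    (∏ i ∈ s, u i) ^ p * (∏ i ∈ s, v i) ^ q ≤ ∏ i ∈ s, (p * u i + q * v i) := by
  rw [← Real.finsetProd_rpow _ _ fun i _ => hu i, ← Real.finsetProd_rpow _ _ fun i _ => hv i,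
    ← Finset.prod_mul_distrib]
  exact Finset.prod_le_prod (fun i _ => mul_nonneg (Real.rpow_nonneg (hu i) _)
    (Real.rpow_nonneg (hv i) _)) fun i _ =>
    Real.geom_mean_le_arith_mean2_weighted hp hq (hu i) (hv i) hpq

section Interpolation

variable {n : ℕ} {T U : (Fin n → ℝ) → (Fin n → ℝ)} {d e : Fin n → (Fin n → ℝ) → ℝ} {a b : ℝ}

/-- The interpolation of two triangular maps in rotated coordinates is triangular. -/
lemma HasTriangularDeriv.interpolation (hT : HasTriangularDeriv T d) (hU : HasTriangularDeriv U e)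
    (ha : 0 < a) (hb : 0 < b) (y : Fin n → ℝ) :
    HasTriangularDeriv (fun x => a • T (a • x + -(b • y)) + b • U (b • x + a • y))
      (fun i x => a * (a * d i (a • x + -(b • y))) + b * (b * e i (b • x + a • y))) :=
  ((hT.comp_affine ha _).const_smul ha).add ((hU.comp_affine hb _).const_smul hb)

/-- Integration against the Gaussian cancels the division by its density. The mean inequality with
weights a², b² in each coordinate then produces the diagonal Jacobian of the interpolated map, and
triangular change of variables applies. The test function q is kept general: it will be p, and later
p cut off to a set. -/
lemma lintegral_interpolation_le (hT : HasTriangularDeriv T d) (hU : HasTriangularDeriv U e)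
    (ha : 0 < a) (hb : 0 < b) (hab : a ^ 2 + b ^ 2 = 1) (y : Fin n → ℝ)
    {q : (Fin n → ℝ) → ℝ≥0∞} (hq : Measurable q) :
    ∫⁻ x, q (a • T (a • x + -(b • y)) + b • U (b • x + a • y)) *
      ENNReal.ofReal ((∏ i, d i (a • x + -(b • y))) ^ (a ^ 2) *
        (∏ i, e i (b • x + a • y)) ^ (b ^ 2) / stdGaussianPiPDF x) ∂(stdGaussianPi n) ≤
      ∫⁻ z, q z := by
  have hd : Measurable fun x => ∏ i, d i x :=
    Finset.measurable_prod _ fun i _ => hT.measurable_deriv i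
  have he : Measurable fun x => ∏ i, e i x :=
    Finset.measurable_prod _ fun i _ => hU.measurable_deriv i
  have hT' := hT.measurable
  have hU' := hU.measurable
  have hφ := measurable_stdGaussianPiPDF (n := n)
  have hm1 : Measurable fun x : Fin n → ℝ => a • x + -(b • y) := by fun_prop
  have hm2 : Measurable fun x : Fin n → ℝ => b • x + a • y := by fun_prop
  have hm3 : Measurable fun x => q (a • T (a • x + -(b • y)) + b • U (b • x + a • y)) := by fun_prop
  have hm4 : Measurable fun x => ENNReal.ofReal ((∏ i, d i (a • x + -(b • y))) ^ (a ^ 2) *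
      (∏ i, e i (b • x + a • y)) ^ (b ^ 2) / stdGaussianPiPDF x) :=
    ((((hd.comp hm1).pow_const _).mul ((he.comp hm2).pow_const _)).div hφ).ennreal_ofReal
  have hint := lintegral_stdGaussianPi (hm3.mul hm4)
  simp only [Pi.mul_apply] at hint
  rw [hint]
  refine le_trans (lintegral_mono fun x => ?_)
    ((hT.interpolation hU ha hb y).lintegral_comp_mul_prod_le hq)
  have hpos := stdGaussianPiPDF_pos x
  rw [mul_left_comm, ← ENNReal.ofReal_mul hpos.le, mul_div_cancel₀ _ hpos.ne']
  refine mul_le_mul' le_rfl ?_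
  rw [← ENNReal.ofReal_prod_of_nonneg fun i _ => (hT.interpolation hU ha hb y).nonneg i x]
  refine ENNReal.ofReal_le_ofReal ?_
  refine (prod_rpow_mul_prod_rpow_le _ (fun i => hT.nonneg i _) (fun i => hU.nonneg i _)
    (sq_nonneg a) (sq_nonneg b) hab).trans (le_of_eq ?_)
  exact Finset.prod_congr rfl fun i _ => by ring

end Interpolation

/-! ### The equality case for densities -/

/-- Equality in the entropy inequality for `a X + b Y`, where `a² + b² = 1`, forces the densities
of `X` and `Y` to be those of affine images of the standard Gaussian measure, with the same linear
part. -/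
theorem exists_affine_of_entropy_eq {n : ℕ} {f g p : (Fin n → ℝ) → ℝ≥0∞} (hf : Measurable f)
    (hg : Measurable g) (hp : Measurable p) (hf1 : ∫⁻ x, f x = 1) (hg1 : ∫⁻ x, g x = 1)
    {a b : ℝ} (ha : 0 < a) (hb : 0 < b) (hab : a ^ 2 + b ^ 2 = 1)
    (hlaw : ((volume.withDensity f).prod (volume.withDensity g)).map
      (fun z => a • z.1 + b • z.2) = volume.withDensity p)
    (hfi : Integrable (fun x => Real.log (f x).toReal) (volume.withDensity f))
    (hgi : Integrable (fun x => Real.log (g x).toReal) (volume.withDensity g))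
    (hpi : Integrable (fun x => Real.log (p x).toReal) (volume.withDensity p))
    (heq : ∫ x, Real.log (p x).toReal ∂(volume.withDensity p) =
      a ^ 2 * ∫ x, Real.log (f x).toReal ∂(volume.withDensity f) +
      b ^ 2 * ∫ x, Real.log (g x).toReal ∂(volume.withDensity g)) :
    ∃ (L : (Fin n → ℝ) →L[ℝ] (Fin n → ℝ)) (t u : Fin n → ℝ),
      volume.withDensity f = (stdGaussianPi n).map (fun x => L x + t) ∧
      volume.withDensity g = (stdGaussianPi n).map (fun x => L x + u) := by
  obtain ⟨T, d, hT, hTmap, hTjac⟩ := exists_triangular_transport hf hf1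
  obtain ⟨U, e, hU, hUmap, hUjac⟩ := exists_triangular_transport hg hg1
  have hTm := hT.measurable
  have hUm := hU.measurable
  have hdm : Measurable fun x => ∏ i, d i x :=
    Finset.measurable_prod _ fun i _ => hT.measurable_deriv i
  have hem : Measurable fun x => ∏ i, e i x :=
    Finset.measurable_prod _ fun i _ => hU.measurable_deriv i
  have hφm := measurable_stdGaussianPiPDF (n := n)
  set γ := stdGaussianPi n with hγ
  set ρ : (Fin n → ℝ) × (Fin n → ℝ) → (Fin n → ℝ) × (Fin n → ℝ) := fun z =>
    (a • z.1 + -(b • z.2), b • z.1 + a • z.2) with hρ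
  have hρmp : MeasurePreserving ρ (γ.prod γ) (γ.prod γ) :=
    measurePreserving_rotation_stdGaussianPi n ha.le hb.le hab
  have hρinv : ∀ z, a • (ρ z).1 + b • (ρ z).2 = z.1 := by
    intro z
    have : a • (ρ z).1 + b • (ρ z).2 = (a ^ 2 + b ^ 2) • z.1 := by
      simp only [hρ]; module
    rw [this, hab, one_smul]
  set Z : (Fin n → ℝ) × (Fin n → ℝ) → (Fin n → ℝ) := fun z => a • T z.1 + b • U z.2 with hZ
  have hZm : Measurable Z := by fun_prop
  have hZmp : MeasurePreserving Z (γ.prod γ) (volume.withDensity p) := by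
    refine ⟨hZm, ?_⟩
    rw [← hlaw, ← hTmap, ← hUmap, Measure.map_prod_map _ _ hTm hUm, Measure.map_map (by fun_prop)
      (by fun_prop)]
    rfl
  have hpprob : IsProbabilityMeasure (volume.withDensity p) := by
    rw [← hZmp.map_eq]
    exact Measure.isProbabilityMeasure_map hZm.aemeasurable
  have hp1 : ∫⁻ x, p x = 1 := by
    have := measure_univ (μ := volume.withDensity p)
    rwa [withDensity_apply _ MeasurableSet.univ, Measure.restrict_univ] at this
  have hTmp : MeasurePreserving (fun z : (Fin n → ℝ) × (Fin n → ℝ) => T z.1) (γ.prod γ)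
      (volume.withDensity f) := (⟨hTm, hTmap⟩ : MeasurePreserving T γ _).comp measurePreserving_fst
  have hUmp : MeasurePreserving (fun z : (Fin n → ℝ) × (Fin n → ℝ) => U z.2) (γ.prod γ)
      (volume.withDensity g) := (⟨hUm, hUmap⟩ : MeasurePreserving U γ _).comp measurePreserving_snd
  have hcomb : MeasurePreserving (fun z : (Fin n → ℝ) × (Fin n → ℝ) => a • z.1 + b • z.2)
      (γ.prod γ) γ := by
    refine ⟨by fun_prop, ?_⟩
    conv_lhs => rw [← hρmp.map_eq, Measure.map_map (by fun_prop) hρmp.measurable]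
    have : (fun z : (Fin n → ℝ) × (Fin n → ℝ) => a • z.1 + b • z.2) ∘ ρ = Prod.fst :=
      funext hρinv
    rw [this]
    exact measurePreserving_fst.map_eq
  -- the logarithm of the likelihood ratio
  set R : (Fin n → ℝ) × (Fin n → ℝ) → ℝ := fun z =>
    (∏ i, d i z.1) ^ (a ^ 2) * (∏ i, e i z.2) ^ (b ^ 2) / stdGaussianPiPDF (a • z.1 + b • z.2)
    with hR
  have hRm : Measurable R := (((hdm.comp measurable_fst).pow_const _).mul
    ((hem.comp measurable_snd).pow_const _)).div (by fun_prop)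
  have hφi := integrable_log_stdGaussianPiPDF n
  set r : (Fin n → ℝ) × (Fin n → ℝ) → ℝ := fun z =>
    Real.log (p (Z z)).toReal +
      (a ^ 2 * (Real.log (stdGaussianPiPDF z.1) - Real.log (f (T z.1)).toReal) +
      b ^ 2 * (Real.log (stdGaussianPiPDF z.2) - Real.log (g (U z.2)).toReal)) -
      Real.log (stdGaussianPiPDF (a • z.1 + b • z.2)) with hr
  have i1 : Integrable (fun z => Real.log (p (Z z)).toReal) (γ.prod γ) :=
    hZmp.integrable_comp_of_integrable hpi
  have i2 : Integrable (fun z : (Fin n → ℝ) × (Fin n → ℝ) => Real.log (f (T z.1)).toReal)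
      (γ.prod γ) := hTmp.integrable_comp_of_integrable hfi
  have i3 : Integrable (fun z : (Fin n → ℝ) × (Fin n → ℝ) => Real.log (g (U z.2)).toReal)
      (γ.prod γ) := hUmp.integrable_comp_of_integrable hgi
  have i4 : Integrable (fun z : (Fin n → ℝ) × (Fin n → ℝ) => Real.log (stdGaussianPiPDF z.1))
      (γ.prod γ) := measurePreserving_fst.integrable_comp_of_integrable hφi
  have i5 : Integrable (fun z : (Fin n → ℝ) × (Fin n → ℝ) => Real.log (stdGaussianPiPDF z.2))
      (γ.prod γ) := measurePreserving_snd.integrable_comp_of_integrable hφi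
  have i6 : Integrable (fun z : (Fin n → ℝ) × (Fin n → ℝ) =>
      Real.log (stdGaussianPiPDF (a • z.1 + b • z.2))) (γ.prod γ) :=
    hcomb.integrable_comp_of_integrable hφi
  have hint : ∀ {h : (Fin n → ℝ) → ℝ} {W : (Fin n → ℝ) × (Fin n → ℝ) → (Fin n → ℝ)}
      {m : Measure (Fin n → ℝ)}, MeasurePreserving W (γ.prod γ) m → Measurable h →
      ∫ z, h (W z) ∂(γ.prod γ) = ∫ x, h x ∂m := by
    intro h W m hW hh
    rw [← hW.map_eq, integral_map hW.measurable.aemeasurable hh.aestronglyMeasurable]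
  have j7 : Integrable (fun z : (Fin n → ℝ) × (Fin n → ℝ) =>
      a ^ 2 * (Real.log (stdGaussianPiPDF z.1) - Real.log (f (T z.1)).toReal)) (γ.prod γ) :=
    (i4.sub i2).const_mul _
  have j8 : Integrable (fun z : (Fin n → ℝ) × (Fin n → ℝ) =>
      b ^ 2 * (Real.log (stdGaussianPiPDF z.2) - Real.log (g (U z.2)).toReal)) (γ.prod γ) :=
    (i5.sub i3).const_mul _
  have j9 : Integrable (fun z : (Fin n → ℝ) × (Fin n → ℝ) =>
      a ^ 2 * (Real.log (stdGaussianPiPDF z.1) - Real.log (f (T z.1)).toReal) +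
      b ^ 2 * (Real.log (stdGaussianPiPDF z.2) - Real.log (g (U z.2)).toReal)) (γ.prod γ) :=
    j7.add j8
  have j10 : Integrable (fun z : (Fin n → ℝ) × (Fin n → ℝ) => Real.log (p (Z z)).toReal +
      (a ^ 2 * (Real.log (stdGaussianPiPDF z.1) - Real.log (f (T z.1)).toReal) +
      b ^ 2 * (Real.log (stdGaussianPiPDF z.2) - Real.log (g (U z.2)).toReal))) (γ.prod γ) :=
    i1.add j9
  have hri : Integrable r (γ.prod γ) := j10.sub i6
  -- The three Gaussian terms have the same integral up to the weights a², b², -1 and cancel; what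
  -- remains is the assumed equality of entropies.
  have hr0 : ∫ z, r z ∂(γ.prod γ) = 0 := by
    simp only [hr]
    rw [integral_sub j10 i6, integral_add i1 j9,
      integral_add j7 j8, integral_const_mul, integral_const_mul, integral_sub i4 i2,
      integral_sub i5 i3,
      hint (h := fun x => Real.log (p x).toReal) hZmp (by fun_prop),
      hint (h := fun x => Real.log (f x).toReal) hTmp (by fun_prop),
      hint (h := fun x => Real.log (g x).toReal) hUmp (by fun_prop),
      hint (h := fun x => Real.log (stdGaussianPiPDF x)) measurePreserving_fst (by fun_prop),
      hint (h := fun x => Real.log (stdGaussianPiPDF x)) measurePreserving_snd (by fun_prop),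
      hint (h := fun x => Real.log (stdGaussianPiPDF x)) hcomb (by fun_prop), heq]
    linear_combination (∫ x, Real.log (stdGaussianPiPDF x) ∂γ) * hab
  have hae : ∀ᵐ z ∂(γ.prod γ), p (Z z) * ENNReal.ofReal (R z) =
      ENNReal.ofReal (Real.exp (r z)) := by
    have hpp := hZmp.quasiMeasurePreserving.ae
      (ae_pos_lt_top_withDensity hp (by rw [hp1]; exact ENNReal.one_ne_top))
    have hfp := hTmp.quasiMeasurePreserving.ae
      (ae_pos_lt_top_withDensity hf (by rw [hf1]; exact ENNReal.one_ne_top))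
    have hgp := hUmp.quasiMeasurePreserving.ae
      (ae_pos_lt_top_withDensity hg (by rw [hg1]; exact ENNReal.one_ne_top))
    have hTj := (measurePreserving_fst (μ := γ) (ν := γ)).quasiMeasurePreserving.ae hTjac
    have hUj := (measurePreserving_snd (μ := γ) (ν := γ)).quasiMeasurePreserving.ae hUjac
    filter_upwards [hpp, hfp, hgp, hTj, hUj] with z h1 h2 h3 h4 h5
    have p1 := ENNReal.toReal_pos h1.1.ne' h1.2.ne
    have p2 := ENNReal.toReal_pos h2.1.ne' h2.2.ne
    have p3 := ENNReal.toReal_pos h3.1.ne' h3.2.ne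
    have q1 := stdGaussianPiPDF_pos z.1
    have q2 := stdGaussianPiPDF_pos z.2
    have q3 := stdGaussianPiPDF_pos (a • z.1 + b • z.2)
    have e1 : ∏ i, d i z.1 = stdGaussianPiPDF z.1 / (f (T z.1)).toReal := by
      rw [← h4]; field_simp
    have e2 : ∏ i, e i z.2 = stdGaussianPiPDF z.2 / (g (U z.2)).toReal := by
      rw [← h5]; field_simp
    rw [← ENNReal.ofReal_toReal h1.2.ne, ← ENNReal.ofReal_mul p1.le]
    congr 1
    simp only [hR, hr]
    rw [e1, e2, Real.exp_sub, Real.exp_add, Real.exp_add, Real.exp_log p1, Real.exp_log q3,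
      ← Real.log_div q1.ne' p2.ne', ← Real.log_div q2.ne' p3.ne',
      Real.rpow_def_of_pos (div_pos q1 p2), Real.rpow_def_of_pos (div_pos q2 p3),
      mul_comm (a ^ 2), mul_comm (b ^ 2)]
    ring
  have hRρ : ∀ x y, R (ρ (x, y)) = (∏ i, d i (a • x + -(b • y))) ^ (a ^ 2) *
      (∏ i, e i (b • x + a • y)) ^ (b ^ 2) / stdGaussianPiPDF x := by
    intro x y
    simp only [hR]
    rw [hρinv]
  have hslice : ∀ y {q : (Fin n → ℝ) → ℝ≥0∞}, Measurable q →
      ∫⁻ x, q (Z (ρ (x, y))) * ENNReal.ofReal (R (ρ (x, y))) ∂γ ≤ ∫⁻ z, q z := by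
    intro y q hq
    simp_rw [hRρ]
    exact lintegral_interpolation_le hT hU ha hb hab y hq
  -- In rotated coordinates each slice with y fixed contributes at most ∫ p = 1.
  have hle : ∫⁻ z, ENNReal.ofReal (Real.exp (r z)) ∂(γ.prod γ) ≤ 1 := by
    have hm : Measurable fun z => p (Z z) * ENNReal.ofReal (R z) := by fun_prop
    rw [← lintegral_congr_ae hae, ← hρmp.lintegral_comp hm,
      lintegral_prod_symm (fun z => p (Z (ρ z)) * ENNReal.ofReal (R (ρ z)))
        (hm.comp hρmp.measurable).aemeasurable]
    calc _ ≤ ∫⁻ _, 1 ∂γ := lintegral_mono fun y => (hslice y hp).trans hp1.le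
      _ = 1 := by simp
  have hr1 := ae_eq_zero_of_lintegral_exp_le_one hri hr0 hle
  have hone : ∀ᵐ z ∂(γ.prod γ), p (Z z) * ENNReal.ofReal (R z) = 1 := by
    filter_upwards [hae, hr1] with z h1 h2
    rw [h1, h2]; simp
  have hone' : ∀ᵐ y ∂γ, ∀ᵐ x ∂γ, p (Z (ρ (x, y))) * ENNReal.ofReal (R (ρ (x, y))) = 1 :=
    Measure.ae_ae_of_ae_prod ((hρmp.comp (Measure.measurePreserving_swap
      (μ := γ) (ν := γ))).quasiMeasurePreserving.ae hone)
  have hZρ : ∀ y, Measurable fun x => Z (ρ (x, y)) := fun y => by fun_prop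
  -- Since the likelihood ratio is 1, it may be inserted under the integral; the slice inequality
  -- for p cut off to B shows domination of measures, and both have mass 1.
  have hsmap : ∀ᵐ y ∂γ, γ.map (fun x => Z (ρ (x, y))) = volume.withDensity p := by
    filter_upwards [hone'] with y hy
    have := Measure.isProbabilityMeasure_map (μ := γ) (hZρ y).aemeasurable
    refine Measure.eq_of_le_of_measure_univ_eq (Measure.le_iff.2 fun B hB => ?_)
      (by rw [measure_univ, measure_univ])
    have hind : Measurable (B.indicator (fun _ => (1 : ℝ≥0∞))) := measurable_const.indicator hB
    calc γ.map (fun x => Z (ρ (x, y))) B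
        = ∫⁻ x, B.indicator (fun _ => 1) (Z (ρ (x, y))) ∂γ := by
          rw [← lintegral_map hind (hZρ y), lintegral_indicator hB]; simp
      _ = ∫⁻ x, (B.indicator (fun _ => 1) (Z (ρ (x, y))) * p (Z (ρ (x, y)))) *
            ENNReal.ofReal (R (ρ (x, y))) ∂γ := by
          refine lintegral_congr_ae ?_
          filter_upwards [hy] with x hx
          rw [mul_assoc, hx, mul_one]
      _ ≤ ∫⁻ z, B.indicator (fun _ => 1) z * p z := hslice y (hind.mul hp)
      _ = volume.withDensity p B := by
          rw [withDensity_apply _ hB, ← lintegral_indicator hB]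
          refine lintegral_congr fun z => ?_
          by_cases hz : z ∈ B <;> simp [hz]
  have htri : ∀ y, IsTriangular fun x => Z (ρ (x, y)) := fun y =>
    (hT.interpolation hU ha hb y).triangular
  obtain ⟨y₀, hy₀⟩ := hsmap.exists
  set S : (Fin n → ℝ) → (Fin n → ℝ) := fun x => Z (ρ (x, y₀)) with hS
  have hSm : Measurable S := hZρ y₀
  -- By uniqueness of triangular transport almost every slice map equals the one at `y₀`; undoing
  -- the rotation yields Pexider's equation.
  have hfun : ∀ᵐ z ∂(γ.prod γ), a • T z.1 + b • U z.2 = S (a • z.1 + b • z.2) := by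
    have hset : MeasurableSet {z : (Fin n → ℝ) × (Fin n → ℝ) | Z z = S (a • z.1 + b • z.2)} :=
      measurableSet_eq_fun hZm (by fun_prop)
    have h1 : ∀ᵐ y ∂γ, ∀ᵐ x ∂γ, Z (ρ (x, y)) = S (a • (ρ (x, y)).1 + b • (ρ (x, y)).2) := by
      filter_upwards [hsmap] with y hy
      have := (htri y).ae_eq_of_map_eq (gaussianReal 0 1) (htri y₀) (hZρ y) (hZρ y₀)
        (hy.trans hy₀.symm)
      filter_upwards [this] with x hx
      rw [hρinv, hx]
    have hmp := hρmp.comp (Measure.measurePreserving_swap (μ := γ) (ν := γ))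
    rw [← hmp.map_eq]
    refine (ae_map_iff hmp.measurable.aemeasurable hset).2 ?_
    exact (Measure.ae_prod_iff_ae_ae (hmp.measurable hset)).2 h1
  have hvol := absolutelyContinuous_stdGaussianPi n
  have hfun' := (hvol.prod hvol).ae_le hfun
  obtain ⟨L, t, u, hTL, hUL⟩ := ae_eq_affine_of_pexider hTm hUm ha.ne' hb.ne' hfun'
  refine ⟨L, t, u, ?_, ?_⟩
  · rw [← hTmap]
    exact Measure.map_congr ((stdGaussianPi_absolutelyContinuous n).ae_le hTL)
  · rw [← hUmap]
    exact Measure.map_congr ((stdGaussianPi_absolutelyContinuous n).ae_le hUL)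

/-! ### Differential entropy and Gaussian random vectors -/

section DiffEntropy

variable {Ω : Type*} [MeasurableSpace Ω] {P : Measure Ω} {n : ℕ}
  {X Y : Ω → EuclideanSpace ℝ (Fin n)}

/-- A differential entropy that is not infinite is an absolutely convergent integral. -/
lemma integrable_negMulLog_pdf (hbot : diffEntropy P X ≠ ⊥) (htop : diffEntropy P X ≠ ⊤) :
    Integrable (fun x => Real.negMulLog (pdf X P volume x).toReal) ∧
      diffEntropy P X = ((∫ x, Real.negMulLog (pdf X P volume x).toReal : ℝ) : EReal) := by
  have hm : Measurable fun x => Real.negMulLog (pdf X P volume x).toReal :=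
    Real.continuous_negMulLog.measurable.comp (measurable_pdf X P volume).ennreal_toReal
  unfold diffEntropy at *
  set A := ∫⁻ x, ENNReal.ofReal (Real.negMulLog (pdf X P volume x).toReal) with hA
  set B := ∫⁻ x, ENNReal.ofReal (-Real.negMulLog (pdf X P volume x).toReal) with hB
  -- In `EReal` subtracting ⊤ always gives ⊥, so excluding ⊥ bounds the negative part first,
  -- including the case ∞ - ∞.
  have hBt : B ≠ ∞ := by
    intro h
    rw [h, EReal.coe_ennreal_top, EReal.sub_top] at hbot
    exact hbot rfl
  have hAt : A ≠ ∞ := by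
    intro h
    rw [h, EReal.coe_ennreal_top, EReal.top_sub (by simpa using hBt)] at htop
    exact htop rfl
  have hint : Integrable (fun x => Real.negMulLog (pdf X P volume x).toReal) := by
    refine ⟨hm.aestronglyMeasurable, ?_⟩
    rw [hasFiniteIntegral_iff_norm]
    calc ∫⁻ x, ENNReal.ofReal ‖Real.negMulLog (pdf X P volume x).toReal‖
        ≤ ∫⁻ x, (ENNReal.ofReal (Real.negMulLog (pdf X P volume x).toReal) +
          ENNReal.ofReal (-Real.negMulLog (pdf X P volume x).toReal)) := by
          refine lintegral_mono fun x => ?_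
          rcases le_total 0 (Real.negMulLog (pdf X P volume x).toReal) with h | h
          · rw [Real.norm_of_nonneg h]; exact le_self_add
          · rw [Real.norm_of_nonpos h]; exact le_add_self
      _ = A + B := lintegral_add_left hm.ennreal_ofReal _
      _ < ∞ := ENNReal.add_lt_top.2 ⟨hAt.lt_top, hBt.lt_top⟩
  refine ⟨hint, ?_⟩
  rw [integral_eq_lintegral_pos_part_sub_lintegral_neg_part hint, EReal.coe_sub]
  rw [← hA, ← hB, EReal.coe_ennreal_toReal hAt, EReal.coe_ennreal_toReal hBt]

/-- The density of a random vector, as a function on `Fin n → ℝ`. -/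
noncomputable def coordPDF (P : Measure Ω) (X : Ω → EuclideanSpace ℝ (Fin n)) (x : Fin n → ℝ) :
    ℝ≥0∞ :=
  pdf X P volume (WithLp.toLp 2 x)

lemma measurable_coordPDF : Measurable (coordPDF P X) :=
  (measurable_pdf X P volume).comp (MeasurableEquiv.toLp 2 (Fin n → ℝ)).measurable

lemma map_ofLp_eq_withDensity [hX : HasPDF X P volume] :
    P.map (fun ω => WithLp.ofLp (X ω)) = volume.withDensity (coordPDF P X) := by
  have hm : Measurable (WithLp.ofLp : EuclideanSpace ℝ (Fin n) → Fin n → ℝ) :=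
    (MeasurableEquiv.toLp 2 (Fin n → ℝ)).symm.measurable
  have h1 : P.map (fun ω => WithLp.ofLp (X ω)) = (P.map X).map WithLp.ofLp :=
    (AEMeasurable.map_map_of_aemeasurable hm.aemeasurable hX.aemeasurable).symm
  rw [h1, map_eq_withDensity_pdf X P volume]
  ext s hs
  rw [Measure.map_apply hm hs, withDensity_apply _ (hm hs), withDensity_apply _ hs]
  exact (PiLp.volume_preserving_ofLp (Fin n)).setLIntegral_comp_preimage_emb
    (MeasurableEquiv.toLp 2 (Fin n → ℝ)).symm.measurableEmbedding (coordPDF P X) s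

lemma lintegral_coordPDF [IsProbabilityMeasure P] [hX : HasPDF X P volume] :
    ∫⁻ x, coordPDF P X x = 1 := by
  have hm : AEMeasurable (fun ω => WithLp.ofLp (X ω)) P :=
    (MeasurableEquiv.toLp 2 (Fin n → ℝ)).symm.measurable.comp_aemeasurable hX.aemeasurable
  have h := Measure.isProbabilityMeasure_map hm
  rw [map_ofLp_eq_withDensity] at h
  have := h.measure_univ
  rwa [withDensity_apply _ MeasurableSet.univ, Measure.restrict_univ] at this

/-- Entropy as minus the expectation of log f under the law itself, the form that can be pulled back
along transport maps. -/
lemma integral_log_coordPDF [IsProbabilityMeasure P] [hX : HasPDF X P volume]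
    (hbot : diffEntropy P X ≠ ⊥) (htop : diffEntropy P X ≠ ⊤) :
    Integrable (fun x => Real.log (coordPDF P X x).toReal) (volume.withDensity (coordPDF P X)) ∧
      diffEntropy P X =
        ((-∫ x, Real.log (coordPDF P X x).toReal ∂(volume.withDensity (coordPDF P X)) : ℝ) :
          EReal) := by
  obtain ⟨hint, heq⟩ := integrable_negMulLog_pdf hbot htop
  have hfin : ∀ᵐ x, coordPDF P X x < ∞ :=
    ae_lt_top measurable_coordPDF (by rw [lintegral_coordPDF]; exact ENNReal.one_ne_top)
  have hmp := PiLp.volume_preserving_toLp (Fin n)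
  have hemb := (MeasurableEquiv.toLp 2 (Fin n → ℝ)).measurableEmbedding
  have hint' : Integrable fun x : Fin n → ℝ => Real.negMulLog (coordPDF P X x).toReal :=
    (hmp.integrable_comp_emb hemb).2 hint
  refine ⟨?_, ?_⟩
  · rw [integrable_withDensity_iff measurable_coordPDF hfin]
    refine hint'.neg.congr (Filter.Eventually.of_forall fun x => ?_)
    simp [Real.negMulLog, mul_comm]
  · rw [heq, integral_withDensity_eq_integral_toReal_smul measurable_coordPDF hfin,
      ← hmp.integral_comp hemb, ← integral_neg]
    congr 2
    funext x
    simp [Real.negMulLog, coordPDF]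

lemma hasPDF_const_smul [IsProbabilityMeasure P] [hX : HasPDF X P volume] {c : ℝ} (hc : c ≠ 0) :
    HasPDF (fun ω => c • X ω) P volume := by
  refine (hasPDF_iff_of_aemeasurable (hX.aemeasurable.const_smul c)).2 ⟨inferInstance, ?_⟩
  have hm : Measurable fun x : EuclideanSpace ℝ (Fin n) => c • x := measurable_const_smul c
  have e : P.map (fun ω => c • X ω) = (P.map X).map (fun x => c • x) :=
    (AEMeasurable.map_map_of_aemeasurable hm.aemeasurable hX.aemeasurable).symm
  refine e.absolutelyContinuous.trans ?_
  refine (hX.absolutelyContinuous.map hm).trans ?_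
  rw [Measure.map_addHaar_smul _ hc]
  exact Measure.smul_absolutelyContinuous

/-- Differential entropy is invariant under translations of the law. -/
lemma diffEntropy_eq_of_map_eq_translate [hX : HasPDF X P volume] (hY : AEMeasurable Y P)
    {c : EuclideanSpace ℝ (Fin n)} (h : P.map Y = (P.map X).map (fun x => x + c)) :
    diffEntropy P Y = diffEntropy P X := by
  have hm : Measurable fun x => pdf X P volume (x - c) :=
    (measurable_pdf X P volume).comp (measurable_id.sub_const c)
  have h1 : P.map Y = volume.withDensity fun x => pdf X P volume (x - c) := by
    rw [h, map_eq_withDensity_pdf X P volume]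
    ext s hs
    have hadd : Measurable fun x : EuclideanSpace ℝ (Fin n) => x + c := measurable_id.add_const c
    rw [Measure.map_apply hadd hs, withDensity_apply _ (hadd hs), withDensity_apply _ hs]
    simpa using (measurePreserving_add_right volume c).setLIntegral_comp_preimage_emb
      (measurableEmbedding_addRight c) (fun x => pdf X P volume (x - c)) s
  have : HasPDF Y P volume := hasPDF_of_map_eq_withDensity hY _ hm.aemeasurable h1
  have h2 := (pdf.eq_of_map_eq_withDensity' (X := Y) _ hm.aemeasurable).1 h1
  have key : ∀ F : ℝ≥0∞ → ℝ≥0∞, ∫⁻ x, F (pdf Y P volume x) = ∫⁻ x, F (pdf X P volume x) := by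
    intro F
    rw [lintegral_congr_ae (h2.mono fun x hx => congrArg F hx)]
    exact lintegral_sub_right_eq_self (fun x => F (pdf X P volume x)) c
  unfold diffEntropy
  rw [key fun u => ENNReal.ofReal (Real.negMulLog u.toReal),
    key fun u => ENNReal.ofReal (-Real.negMulLog u.toReal)]

/-- After shifting X by the difference of means, all linear functionals agree in mean and variance,
so the characteristic functions coincide and Y is a translate of X in law. -/
lemma diffEntropy_eq_of_hasGaussianLaw [IsProbabilityMeasure P] [hXd : HasPDF X P volume]
    (hX : HasGaussianLaw X P) (hY : HasGaussianLaw Y P)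
    (h : ∀ t, Var[fun ω => inner ℝ t (X ω); P] = Var[fun ω => inner ℝ t (Y ω); P]) :
    diffEntropy P Y = diffEntropy P X := by
  set c := (∫ ω, Y ω ∂P) - ∫ ω, X ω ∂P with hc
  have hXc : HasGaussianLaw (fun ω => X ω + c) P := by
    have := hX.isGaussian_map
    refine ⟨?_⟩
    have e : P.map (fun ω => X ω + c) = (P.map X).map (fun x => x + c) :=
      (AEMeasurable.map_map_of_aemeasurable (measurable_id.add_const c).aemeasurable
        hX.aemeasurable).symm
    rw [e]
    infer_instance
  refine diffEntropy_eq_of_map_eq_translate hY.aemeasurable (c := c) ?_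
  have e : (P.map X).map (fun x => x + c) = P.map (fun ω => X ω + c) :=
    AEMeasurable.map_map_of_aemeasurable (measurable_id.add_const c).aemeasurable hX.aemeasurable
  rw [e]
  have := Measure.isProbabilityMeasure_map hY.aemeasurable
  have := Measure.isProbabilityMeasure_map hXc.aemeasurable
  refine Measure.ext_of_charFun (funext fun t => ?_)
  rw [hY.charFun_map_eq, hXc.charFun_map_eq]
  have hXi : Integrable (fun ω => inner ℝ t (X ω)) P := hX.integrable.const_inner t
  have v : Var[fun ω => inner ℝ t (X ω + c); P] = Var[fun ω => inner ℝ t (Y ω); P] := by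
    simp_rw [inner_add_right]
    rw [variance_add_const hXi.1, h]
  have m : ∫ ω, inner ℝ t (X ω + c) ∂P = ∫ ω, inner ℝ t (Y ω) ∂P := by
    rw [integral_inner hXc.integrable, integral_inner hY.integrable,
      integral_add hX.integrable (integrable_const c)]
    simp [hc]
  rw [v, m]

lemma variance_inner_eq_sum_covariance [IsProbabilityMeasure P] (hX : HasGaussianLaw X P)
    (t : EuclideanSpace ℝ (Fin n)) :
    Var[fun ω => inner ℝ t (X ω); P] =
      ∑ i, ∑ j, t i * (t j * cov[fun ω => X ω i, fun ω => X ω j; P]) := by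
  have hi : ∀ i, MemLp (fun ω => X ω i) 2 P := fun i =>
    (hX.map_fun (EuclideanSpace.proj i : EuclideanSpace ℝ (Fin n) →L[ℝ] ℝ)).memLp_two
  have e : (fun ω => inner ℝ t (X ω)) = fun ω => ∑ i, t i * X ω i := by
    funext ω
    simp [PiLp.inner_apply, mul_comm]
  rw [e, variance_fun_sum' fun i _ => (hi i).const_mul (t i)]
  simp_rw [covariance_const_mul_left, covariance_const_mul_right]

lemma hasGaussianLaw_smul_add_smul [IsProbabilityMeasure P] (hX : HasGaussianLaw X P)
    (hY : HasGaussianLaw Y P) (hXY : IndepFun X Y P) (a b : ℝ) :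
    HasGaussianLaw (fun ω => a • X ω + b • Y ω) P :=
  (hXY.hasGaussianLaw hX hY).map_fun
    (a • ContinuousLinearMap.fst ℝ (EuclideanSpace ℝ (Fin n)) (EuclideanSpace ℝ (Fin n)) +
      b • ContinuousLinearMap.snd ℝ (EuclideanSpace ℝ (Fin n)) (EuclideanSpace ℝ (Fin n)))

lemma variance_inner_smul_add_smul [IsProbabilityMeasure P] (hX : HasGaussianLaw X P)
    (hY : HasGaussianLaw Y P) (hXY : IndepFun X Y P) {a b : ℝ} (hab : a ^ 2 + b ^ 2 = 1)
    (t : EuclideanSpace ℝ (Fin n))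
    (h : Var[fun ω => inner ℝ t (X ω); P] = Var[fun ω => inner ℝ t (Y ω); P]) :
    Var[fun ω => inner ℝ t (X ω); P] = Var[fun ω => inner ℝ t (a • X ω + b • Y ω); P] := by
  have hm : Measurable fun x : EuclideanSpace ℝ (Fin n) => inner ℝ t x := by fun_prop
  simp_rw [inner_add_right, real_inner_smul_right]
  have hXi : MemLp (fun ω => inner ℝ t (X ω)) 2 P := hX.memLp_two.const_inner t
  have hYi : MemLp (fun ω => inner ℝ t (Y ω)) 2 P := hY.memLp_two.const_inner t
  have hind : IndepFun (fun ω => a * inner ℝ t (X ω)) (fun ω => b * inner ℝ t (Y ω)) P :=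
    hXY.comp (hm.const_mul a) (hm.const_mul b)
  rw [hind.variance_fun_add (hXi.const_mul a) (hYi.const_mul b), variance_const_mul,
    variance_const_mul, ← h, ← add_mul, hab, one_mul]

/-- A random vector whose coordinates have the law of an affine image of the standard Gaussian
measure is Gaussian. -/
lemma hasGaussianLaw_of_map_ofLp_eq (hX : AEMeasurable X P) {L : (Fin n → ℝ) →L[ℝ] (Fin n → ℝ)}
    {t : Fin n → ℝ}
    (h : P.map (fun ω => WithLp.ofLp (X ω)) = (stdGaussianPi n).map (fun x => L x + t)) :
    HasGaussianLaw X P ∧ ∀ i j : Fin n, cov[fun ω => X ω i, fun ω => X ω j; P] =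
      cov[fun x => L x i, fun x => L x j; stdGaussianPi n] := by
  have hL : Measurable fun x => L x + t := L.measurable.add_const t
  have hX' : AEMeasurable (fun ω => WithLp.ofLp (X ω)) P :=
    (MeasurableEquiv.toLp 2 (Fin n → ℝ)).symm.measurable.comp_aemeasurable hX
  have e : (stdGaussianPi n).map (fun x => L x + t) =
      ((stdGaussianPi n).map L).map (fun x => x + t) :=
    (Measure.map_map (measurable_id.add_const t) L.measurable).symm
  constructor
  · have hg : HasGaussianLaw (fun ω => WithLp.ofLp (X ω)) P := by
      refine ⟨?_⟩
      rw [h, e]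
      infer_instance
    exact hg.map_equiv_fun (EuclideanSpace.equiv (Fin n) ℝ).symm
  · intro i j
    have hi : ∀ i, Integrable (fun x => L x i) (stdGaussianPi n) := fun i =>
      IsGaussian.integrable_dual (stdGaussianPi n)
        ((ContinuousLinearMap.proj i : (Fin n → ℝ) →L[ℝ] ℝ).comp L)
    have h1 := covariance_map (μ := P) (Z := fun ω => WithLp.ofLp (X ω))
      (X := fun x : Fin n → ℝ => x i) (Y := fun x : Fin n → ℝ => x j)
      (measurable_pi_apply i).aestronglyMeasurable (measurable_pi_apply j).aestronglyMeasurable hX'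
    have h2 := covariance_map (μ := stdGaussianPi n) (Z := fun x => L x + t)
      (X := fun x : Fin n → ℝ => x i) (Y := fun x : Fin n → ℝ => x j)
      (measurable_pi_apply i).aestronglyMeasurable (measurable_pi_apply j).aestronglyMeasurable
      hL.aemeasurable
    rw [h, h2] at h1
    refine h1.symm.trans ?_
    change cov[fun x => L x i + t i, fun x => L x j + t j; stdGaussianPi n] = _
    rw [covariance_add_const_left (hi i), covariance_add_const_right (hi j)]

end DiffEntropy

theorem mainTheorem2 {Ω : Type*} [MeasurableSpace Ω] (P : Measure Ω) [IsProbabilityMeasure P]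
    (n : ℕ) (X Y : Ω → EuclideanSpace ℝ (Fin n))
    (hX : HasPDF X P volume) (hY : HasPDF Y P volume) (hXY : IndepFun X Y P)
    (hX_bot : diffEntropy P X ≠ ⊥) (hX_top : diffEntropy P X ≠ ⊤)
    (hY_bot : diffEntropy P Y ≠ ⊥) (hY_top : diffEntropy P Y ≠ ⊤)
    (lam : ℝ) (hlam_pos : 0 < lam) (hlam_lt : lam < 1) :
    diffEntropy P (fun ω => Real.sqrt lam • X ω + Real.sqrt (1 - lam) • Y ω) =
        (lam : EReal) * diffEntropy P X + ((1 - lam : ℝ) : EReal) * diffEntropy P Y ↔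
      HasGaussianLaw X P ∧ HasGaussianLaw Y P ∧
        ∀ i j : Fin n, cov[fun ω => X ω i, fun ω => X ω j; P] =
          cov[fun ω => Y ω i, fun ω => Y ω j; P] := by
  have ha2 : √lam ^ 2 = lam := Real.sq_sqrt hlam_pos.le
  have hb2 : √(1 - lam) ^ 2 = 1 - lam := Real.sq_sqrt (by linarith)
  have ha : 0 < √lam := Real.sqrt_pos.2 hlam_pos
  have hb : 0 < √(1 - lam) := Real.sqrt_pos.2 (by linarith)
  have hab : √lam ^ 2 + √(1 - lam) ^ 2 = 1 := by rw [ha2, hb2]; ring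
  obtain ⟨hfi, hXe⟩ := integral_log_coordPDF hX_bot hX_top
  obtain ⟨hgi, hYe⟩ := integral_log_coordPDF hY_bot hY_top
  constructor
  · intro heq
    set a := √lam
    set b := √(1 - lam)
    rw [hXe, hYe, ← EReal.coe_mul, ← EReal.coe_mul, ← EReal.coe_add] at heq
    have : HasPDF (fun ω => a • X ω) P volume := hasPDF_const_smul ha.ne'
    have : HasPDF (fun ω => b • Y ω) P volume := hasPDF_const_smul hb.ne'
    have hZ : HasPDF (fun ω => a • X ω + b • Y ω) P volume :=
      IndepFun.add_hasPDF (hXY.comp (measurable_const_smul a) (measurable_const_smul b))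
    -- Finiteness of the entropy of the sum is read off the equality, whose right-hand side is a
    -- real number.
    obtain ⟨hpi, hZe⟩ := integral_log_coordPDF (X := fun ω => a • X ω + b • Y ω)
      (by rw [heq]; exact EReal.coe_ne_bot _) (by rw [heq]; exact EReal.coe_ne_top _)
    rw [hZe, EReal.coe_eq_coe_iff] at heq
    have hm : Measurable (WithLp.ofLp : EuclideanSpace ℝ (Fin n) → Fin n → ℝ) :=
      (MeasurableEquiv.toLp 2 (Fin n → ℝ)).symm.measurable
    have hX' : AEMeasurable (fun ω => WithLp.ofLp (X ω)) P := hm.comp_aemeasurable hX.aemeasurable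
    have hY' : AEMeasurable (fun ω => WithLp.ofLp (Y ω)) P := hm.comp_aemeasurable hY.aemeasurable
    have hlaw : ((volume.withDensity (coordPDF P X)).prod (volume.withDensity (coordPDF P Y))).map
        (fun z => a • z.1 + b • z.2) =
        volume.withDensity (coordPDF P fun ω => a • X ω + b • Y ω) := by
      rw [← map_ofLp_eq_withDensity, ← map_ofLp_eq_withDensity, ← map_ofLp_eq_withDensity,
        ← (indepFun_iff_map_prod_eq_prod_map_map hX' hY').1 (hXY.comp hm hm)]
      exact AEMeasurable.map_map_of_aemeasurable (by fun_prop) (hX'.prodMk hY')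
    obtain ⟨L, t, u, h1, h2⟩ := exists_affine_of_entropy_eq measurable_coordPDF
      measurable_coordPDF measurable_coordPDF lintegral_coordPDF lintegral_coordPDF ha hb hab hlaw
      hfi hgi hpi (by rw [ha2, hb2]; linarith)
    rw [← map_ofLp_eq_withDensity] at h1 h2
    obtain ⟨g1, c1⟩ := hasGaussianLaw_of_map_ofLp_eq hX.aemeasurable h1
    obtain ⟨g2, c2⟩ := hasGaussianLaw_of_map_ofLp_eq hY.aemeasurable h2
    exact ⟨g1, g2, fun i j => (c1 i j).trans (c2 i j).symm⟩
  · rintro ⟨gX, gY, hcov⟩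
    have hv : ∀ t, Var[fun ω => inner ℝ t (X ω); P] = Var[fun ω => inner ℝ t (Y ω); P] := by
      intro t
      rw [variance_inner_eq_sum_covariance gX, variance_inner_eq_sum_covariance gY]
      simp_rw [hcov]
    rw [diffEntropy_eq_of_hasGaussianLaw gX gY hv,
      diffEntropy_eq_of_hasGaussianLaw gX (hasGaussianLaw_smul_add_smul gX gY hXY _ _)
        fun t => variance_inner_smul_add_smul gX gY hXY hab t (hv t),
      hXe, ← EReal.coe_mul, ← EReal.coe_mul, ← EReal.coe_add]
    congr 1
    ring
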